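/- \textbf{Theorem 2.} \textit{Model.} Consider $M$ flows of requests sharing one LRU cache, flow $j$ having Poisson arrivals of rate $\lambda_j>0$, all flows being independent. Put $\nu_j=\lambda_j/\sum_i\lambda_i$. Let $(I_n,R_n)_{n\in\mathbb Z}$ be the flow index and the requested data item of the $n$-th request of the mixed stream: these pairs are i.i.d., with $\mathbb P[I_n=j]=\nu_j$, and given $I_n=j$ the item $R_n$ follows the item distribution of flow $j$. Let $d_1,d_2,\dots$ be the data items of all flows (flows may share items), $p^\circ_i=\mathbb P[R_0=d_i]$, and let $s_i\ge 0$ be the size of $d_i$, with $\sup_i s_i<\infty$. The infinitely many items of flow $k$ are listed as $d^{(k)}_1,d^{(k)}_2,\dots$ so that $p^{(k)}_i=\mathbb P[R_0=d^{(k)}_i]$ is non-increasing in $i$; let $q^{(k)}_i=\mathbb P[R_0=d_i^{(k)}\mid I_0=k]$. Let $C_0$ be the total size of the items that precede $R_0$ in the move-to-front list when request $0$ arrives, i.e. of the items whose last request before request $0$ is more recent than that of $R_0$; then $\mathbb P[C_0>x\mid I_0=k]$ is the miss probability of flow $k$ for cache size $x$. Let $m(z)=\sum_i s_i\bigl(1-(1-p^\circ_i)^z\bigr)$,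 $z\ge 0$, assume $m(z)\to\infty$ as $z\to\infty$, and let $m^{\leftarrow}$ be its inverse. Below, $u\sim v$ means $u/v\to1$. \textit{Conditions.} Assume that there is a function $\delta$ with $0<\delta(x)\le 1$ for all large $x$ such that: (i) for every $\epsilon>0$, $f(\epsilon)=\lim_{x\to\infty} m^{\leftarrow}\bigl((1+\epsilon\delta(x))x\bigr)/m^{\leftarrow}(x)$ exists and is finite, and $f(\epsilon)\to1$ as $\epsilon\downarrow0$; (ii) for every $\epsilon>0$ there are $h_2>h_1>0$, $h_4>h_3>0$ and $x_0$ such that, for all $x>x_0$, $h_1<\delta(x)/\delta(x+\epsilon\delta(x))<h_2$ and $h_3<\delta(x-\epsilon\delta(x))/\delta(x)<h_4$; (iii) $\limsup_{x\to\infty}\log (m^{\leftarrow}(x))/(\delta(x)^2x)=0$. Let $k$ be a flow with $\lim_{n\to\infty}q^{(k)}_n/q^{(k)}_{n+1}=1$ and $\bigl(\sum_{i\ge y}q^{(k)}_i\bigr)^{-1}\sim\Phi_k\bigl(1/p^{(k)}_y\bigr)$ as $y\to\infty$ (through the integers), where $\Phi_k(x)\sim x^{\beta_k}l_k(x)$ as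 $x\to\infty$, $\beta_k\ge0$, and $l_k$ is a measurable, eventually positive, slowly varying function, eventually non-decreasing if $\beta_k=0$. \textit{Conclusion.} For every $x\ge0$ the equation $\sum_i s_i\bigl(1-e^{-p^\circ_iT}\bigr)=x$ has a unique solution $T=T(x)\ge0$, and for the Che approximation $\mathbb P_{che}[C_0>x\mid I_0=k]=\sum_{i\ge1}q^{(k)}_ie^{-p^{(k)}_iT(x)}$ one has, as $x\to\infty$, $$\mathbb P_{che}[C_0>x\mid I_0=k]\;\sim\;\mathbb P[C_0>x\mid I_0=k]\;\sim\;\frac{\Gamma(1+\beta_k)}{\Phi_k(m^{\leftarrow}(x))}.$$ -/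

import Mathlib

open Filter Topology Asymptotics MeasureTheory ProbabilityTheory

noncomputable section

/-- The probability that a request of the mixed stream comes from flow `k`, when the flows are
independent Poisson streams with rates `rate`. -/
def flowFraction {M : ℕ} (rate : Fin M → ℝ) (k : Fin M) : ℝ :=
  rate k / ∑ j, rate j

/-- The probability that a request of the mixed stream asks for the item `d`, when flow `j` asks
for its items according to the distribution `law j`. -/
def mixedProb {M : ℕ} (rate : Fin M → ℝ) (law : Fin M → PMF ℕ) (d : ℕ) : ℝ :=
  ∑ j, flowFraction rate j * (law j d).toReal

/-- `M` flows of requests sharing one cache.  The data items requested by the entirety of the flows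
are enumerated by `ℕ`; different flows may share items. -/
structure CacheModel (M : ℕ) where
  /-- arrival rates of the flows -/
  rate : Fin M → ℝ
  rate_pos : ∀ k, 0 < rate k
  /-- distribution of the item requested by a request of flow `k` -/
  law : Fin M → PMF ℕ
  /-- sizes of the items -/
  size : ℕ → ℝ
  size_nonneg : ∀ d, 0 ≤ size d
  size_bdd : BddAbove (Set.range size)
  /-- `item k i` is the `i`-th item in the list of the (infinitely many) items of flow `k` -/
  item : Fin M → ℕ → ℕ
  item_injective : ∀ k, Function.Injective (item k)
  law_support : ∀ k, (law k).support ⊆ Set.range (item k)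
  /-- the list of flow `k` is sorted by the overall popularity of its items -/
  item_sorted : ∀ k, Antitone fun i => mixedProb rate law (item k i)

namespace CacheModel

variable {M : ℕ} (S : CacheModel M)

/-- `ν_k`: the probability that a request comes from flow `k`. -/
def nu (k : Fin M) : ℝ := flowFraction S.rate k

/-- `p°_d`: the probability that a request asks for the item `d`. -/
def pMix (d : ℕ) : ℝ := mixedProb S.rate S.law d

/-- `p_i^{(k)}`: the unconditional probability that a request asks for the `i`-th item of
flow `k`. -/
def p (k : Fin M) (i : ℕ) : ℝ := S.pMix (S.item k i)

/-- `q_i^{(k)}`: the conditional probability, given that a request is from flow `k`, that it asks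
for the `i`-th item of flow `k`. -/
def q (k : Fin M) (i : ℕ) : ℝ := (S.law k (S.item k i)).toReal

/-- `∑_{i ≥ y} q_i^{(k)}`. -/
def qTail (k : Fin M) (y : ℕ) : ℝ := ∑' i, S.q k (y + i)

/-- `m(z) = ∑_i s_i (1 - (1 - p°_i)^z)`. -/
def m (z : ℝ) : ℝ := ∑' d, S.size d * (1 - (1 - S.pMix d) ^ z)

/-- The inverse `m^←` of the increasing continuous function `m` on `[0, ∞)`. -/
def mInv (x : ℝ) : ℝ := sInf {z | 0 ≤ z ∧ x ≤ S.m z}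

/-- `∑_i s_i (1 - e^{-p°_i T})`; the characteristic time `T` of a cache of size `x` solves
`cheSize T = x`. -/
def cheSize (T : ℝ) : ℝ := ∑' d, S.size d * (1 - Real.exp (-(S.pMix d * T)))

/-- The Che approximation of the miss probability of flow `k`, for the characteristic
time `T`. -/
def cheMiss (k : Fin M) (T : ℝ) : ℝ := ∑' i, S.q k i * Real.exp (-(S.p k i * T))

/-- `(I n, R n)`, for `n ∈ ℤ`, are the flow index and the requested item of the `n`-th request of
the stationary mixed stream: they are i.i.d. in `n`, the flow index is `k` with probability `ν_k`,
and a request of flow `k` asks for an item with distribution `law k`. -/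
structure IsRequestStream {Ω : Type*} [MeasurableSpace Ω] (P : Measure Ω)
    (I : ℤ → Ω → Fin M) (R : ℤ → Ω → ℕ) : Prop where
  measurable_flow : ∀ n, Measurable (I n)
  measurable_item : ∀ n, Measurable (R n)
  indep : iIndepFun (fun n ω => (I n ω, R n ω)) P
  joint_law : ∀ n k d, P {ω | I n ω = k ∧ R n ω = d} = ENNReal.ofReal (S.nu k) * S.law k d

end CacheModel

/-- In the move-to-front list just before the `n`-th request of the sequence `r`, the item `d` is in
front of the item `e`: the last access to `d` is more recent than the last access to `e`. -/
def InFrontOf (r : ℤ → ℕ) (n : ℤ) (d e : ℕ) : Prop :=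
  ∃ j < n, r j = d ∧ ∀ i, j ≤ i → i < n → r i ≠ e

open Classical in
/-- `C_n`: the total size of the items that are, under move-to-front, in front of the item requested
by the `n`-th request.  A miss in an LRU cache of size `x` is the event `C_n > x`. -/
def searchCost (size : ℕ → ℝ) (r : ℤ → ℕ) (n : ℤ) : ENNReal :=
  ∑' d, if InFrontOf r n d (r n) then ENNReal.ofReal (size d) else 0

/-- The conditional probability `P[C_0 > x | I_0 = k]`: the miss probability of flow `k` in an LRU
cache of size `x`. -/
def missProb {M : ℕ} (size : ℕ → ℝ) {Ω : Type*} [MeasurableSpace Ω] (P : Measure Ω)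
    (I : ℤ → Ω → Fin M) (R : ℤ → Ω → ℕ) (k : Fin M) (x : ℝ) : ℝ :=
  (P[|{ω | I 0 ω = k}]).real
    {ω | ENNReal.ofReal x < searchCost size (fun n => R n ω) 0}

/-- Slowly varying (measurable, eventually positive) functions. -/
def IsSlowlyVarying (l : ℝ → ℝ) : Prop :=
  Measurable l ∧ (∀ᶠ x in atTop, 0 < l x) ∧
    ∀ c : ℝ, 0 < c → Tendsto (fun x => l (c * x) / l x) atTop (𝓝 1)

end

/-! Write τ = m^←(x) and H(t) = ∑ q_i e^{-p_i t}, the Che miss probability at characteristic time t.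
Both the true miss probability and H(T(x)) turn out to be equivalent to H(τ), and H(t) Φ(t) →
Γ(1+β).

The last limit is an Abelian theorem. Let G(u) be the q-weight of the items with p_i ≤ u. The
relation between tails of q and Φ says that G(1/t) ~ 1/Φ(t) at the points t = 1/p_y. It extends to
all large t because consecutive tails are equivalent and x^β l(x) is almost increasing
(`tendsto_lowWeight_inv_mul`). Then H(t) is the integral of e^{-v} G(v/t), and dominated
convergence, under a polynomial bound from doubling, yields Γ(1+β)/Φ(t) (`tendsto_laplaceSum_mul`).
In particular H is regularly varying and decays at most polynomially.

For the true miss probability, compare with the set of distinct items requested at the n times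
before request 0. If the item of request 0 is in this set, the search cost is at most the total size
of the set; if not, it is at least that size. The item is absent with conditional probability ∑ q_i
(1-p_i)^n, which is close to H(n), and the total size has mean m(n). The occupancy indicators are
not independent but negatively dependent (`integral_prod_hits_le`), so exponential moments are
bounded as in the independent case and Chernoff bounds apply. With relative deviation εδ, the error
is exp(-κ δ² x), smaller than any power of 1/τ by condition (iii), hence negligible against H(τ).

Taking n a little below or above τ makes m(n) differ from x by more than that deviation; condition
(i) says that a factor close to 1 in τ suffices, and regular variation of H makes the change
harmless. Finally, `cheSize` differs from m by at most a constant, while δ(x) x → ∞, so T(x) lies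
between τ and a slightly larger multiple of τ. -/

/-! ### Slowly and regularly varying functions -/

/-- The uniform convergence theorem for slowly varying functions, in additive form. -/
theorem eventually_forall_abs_sub_le_of_tendsto {h : ℝ → ℝ} (hm : Measurable h)
    (hu : ∀ u, Tendsto (fun x => h (x + u) - h x) atTop (𝓝 0)) {ε : ℝ} (hε : 0 < ε) :
    ∀ᶠ x in atTop, ∀ u ∈ Set.Icc (0 : ℝ) 1, |h (x + u) - h x| ≤ ε := by
  by_contra hcon
  obtain ⟨x, hx, hbad⟩ := exists_seq_forall_of_frequently (not_eventually.mp hcon)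
  push Not at hbad
  choose u hu01 hbig using hbad
  -- Pointwise convergence implies convergence in measure on sets of finite measure. Hence, along
  -- any base points tending to infinity, the shifts with increment at least ε/2 eventually occupy
  -- measure below 1/2.
  have key : ∀ (z : ℕ → ℝ), Tendsto z atTop atTop → ∀ K : Set ℝ, volume K ≠ ⊤ →
      ∀ᶠ n in atTop, volume.restrict K {v | ε / 2 ≤ |h (z n + v) - h (z n)|} < 1 / 2 := by
    intro z hz K hK
    have : IsFiniteMeasure (volume.restrict K) := ⟨by simpa using hK.lt_top⟩
    have h1 : TendstoInMeasure (volume.restrict K) (fun n v => h (z n + v) - h (z n)) atTop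
        (fun _ => 0) := by
      apply tendstoInMeasure_of_tendsto_ae
      · intro n
        exact ((hm.comp (measurable_const_add _)).sub_const _).aestronglyMeasurable
      · exact ae_of_all _ fun v => (hu v).comp hz
    have h2 := (tendstoInMeasure_iff_norm.mp h1) (ε / 2) (by positivity)
    have h3 := h2.eventually (gt_mem_nhds (show (0 : ENNReal) < 1 / 2 by simp))
    simpa using h3
  have hxu : Tendsto (fun n => x n + u n) atTop atTop :=
    tendsto_atTop_mono (fun n => by linarith [(hu01 n).1]) hx
  obtain ⟨n, h1, h2⟩ := ((key x hx (Set.Icc 0 2) (by simp)).and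
    (key _ hxu (Set.Icc 0 1) (by simp))).exists
  have hms : ∀ z : ℝ, MeasurableSet {v | ε / 2 ≤ |h (z + v) - h z|} := fun z =>
    measurableSet_le measurable_const ((hm.comp (measurable_const_add _)).sub_const _).abs
  rw [Measure.restrict_apply (hms _)] at h1 h2
  -- Every v in [0, 1] is bad for the base point x n + u n, or else u n + v is bad for x n;
  -- otherwise the triangle inequality contradicts `hbig`. A set of measure 1 is thus covered by two
  -- sets of measure below 1/2.
  have hsub : Set.Icc (0 : ℝ) 1 ⊆
      ({v | ε / 2 ≤ |h (x n + u n + v) - h (x n + u n)|} ∩ Set.Icc 0 1) ∪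
      (fun v => u n + v) ⁻¹' ({v | ε / 2 ≤ |h (x n + v) - h (x n)|} ∩ Set.Icc 0 2) := by
    intro v hv
    by_contra hc
    simp only [Set.mem_union, Set.mem_inter_iff, Set.mem_ofPred_eq, Set.mem_preimage, not_or,
      not_and'] at hc
    have a1 := not_le.mp (hc.1 hv)
    have a2 := not_le.mp (hc.2 ⟨by linarith [(hu01 n).1, hv.1], by linarith [(hu01 n).2, hv.2]⟩)
    have a3 := hbig n
    rw [← add_assoc] at a2
    rw [abs_lt] at a1 a2
    rcases lt_abs.mp a3 with a3 | a3 <;> linarith [a1.1, a1.2, a2.1, a2.2]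
  have := (measure_mono (μ := volume) hsub).trans (measure_union_le _ _)
  rw [measure_preimage_add] at this
  have h3 := this.trans_lt (ENNReal.add_lt_add h2 h1)
  simp [ENNReal.inv_two_add_inv_two] at h3

/-- The uniform convergence theorem for slowly varying functions. -/
theorem IsSlowlyVarying.eventually_uniform {l : ℝ → ℝ} (hl : IsSlowlyVarying l) {ε : ℝ}
    (hε : 0 < ε) :
    ∀ᶠ x in atTop, ∀ c ∈ Set.Icc (1 : ℝ) 2, (1 - ε) * l x ≤ l (c * x) := by
  obtain ⟨hmeas, hpos, hlim⟩ := hl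
  set h : ℝ → ℝ := fun x => Real.log (l (Real.exp x))
  have hposexp : ∀ᶠ x in atTop, 0 < l (Real.exp x) := Real.tendsto_exp_atTop.eventually hpos
  have hh : ∀ u, Tendsto (fun x => h (x + u) - h x) atTop (𝓝 0) := by
    intro u
    have h1 := (hlim (Real.exp u) (Real.exp_pos u)).comp Real.tendsto_exp_atTop
    have h2 := ((Real.continuousAt_log one_ne_zero).tendsto.comp h1)
    rw [Real.log_one] at h2
    refine h2.congr' ?_
    filter_upwards [hposexp, (tendsto_atTop_add_const_right _ u tendsto_id).eventually hposexp]
      with x hx hxu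
    simp only [id] at hxu
    simp only [Function.comp, h]
    rw [← Real.exp_add, add_comm u x, Real.log_div hxu.ne' hx.ne']
  have h1 := eventually_forall_abs_sub_le_of_tendsto
    (Real.measurable_log.comp (hmeas.comp Real.measurable_exp)) hh hε
  have h2 := Real.tendsto_log_atTop.eventually h1
  obtain ⟨X, hX⟩ := eventually_atTop.mp hpos
  filter_upwards [h2, eventually_ge_atTop X, eventually_gt_atTop 0] with x hx hxX hx0 c hc
  have hc0 : 0 < c := by linarith [hc.1]
  have hlx := hX x hxX
  have hlcx := hX (c * x) (by nlinarith [hc.1])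
  have h3 := hx (Real.log c) ⟨Real.log_nonneg hc.1, by
    have := Real.log_le_sub_one_of_pos hc0; linarith [hc.2]⟩
  rw [Function.comp_apply, Function.comp_apply, Function.comp_apply, Function.comp_apply,
    ← Real.log_mul hx0.ne' hc0.ne', Real.exp_log (by positivity),
    Real.exp_log hx0, mul_comm x c, ← Real.log_div hlcx.ne' hlx.ne'] at h3
  have h4 := Real.log_le_sub_one_of_pos (div_pos hlcx hlx)
  have h5 : 1 - ε ≤ l (c * x) / l x := by linarith [(abs_le.mp h3).1]
  rwa [le_div_iff₀ hlx] at h5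

/-- A regularly varying function of positive index is almost increasing; so is an eventually
increasing slowly varying one. -/
theorem IsSlowlyVarying.eventually_almost_monotone {l : ℝ → ℝ} (hl : IsSlowlyVarying l) {β : ℝ}
    (hβ : 0 ≤ β) (hmono : β = 0 → ∃ x₀ : ℝ, MonotoneOn l (Set.Ici x₀)) {ε : ℝ} (hε : 0 < ε) :
    ∀ᶠ x in atTop, ∀ y, x ≤ y → (1 - ε) * (x ^ β * l x) ≤ y ^ β * l y := by
  rcases hβ.eq_or_lt with rfl | hβ
  · obtain ⟨x₀, hx₀⟩ := hmono rfl
    filter_upwards [eventually_ge_atTop x₀, hl.2.1] with x hx hlx y hxy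
    have := hx₀ hx (hx.trans hxy : x₀ ≤ y) hxy
    simp only [Real.rpow_zero, one_mul]
    nlinarith
  -- With this η, doubling the argument never decreases x^β l(x). Losses therefore do not accumulate
  -- over dyadic steps, and only the final partial step, by a factor in [1, 2], costs 1 - η.
  · obtain ⟨η, hη0, hηε, hη1, hηβ⟩ : ∃ η : ℝ, 0 < η ∧ η ≤ ε ∧ η < 1 ∧ 1 ≤ 2 ^ β * (1 - η) := by
      have h1 : (1 : ℝ) < 2 ^ β := Real.one_lt_rpow (by norm_num) hβ
      have h3 : ((2 : ℝ) ^ β)⁻¹ < 1 := inv_lt_one_of_one_lt₀ h1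
      refine ⟨min ε (1 - (2 ^ β)⁻¹), lt_min hε (by linarith), min_le_left _ _, ?_, ?_⟩
      · refine (min_le_right _ _).trans_lt ?_
        have : (0 : ℝ) < (2 ^ β)⁻¹ := by positivity
        linarith
      · have h2 := min_le_right ε (1 - ((2 : ℝ) ^ β)⁻¹)
        calc (1 : ℝ) = 2 ^ β * (2 ^ β)⁻¹ := (mul_inv_cancel₀ (by positivity)).symm
          _ ≤ _ := by gcongr; linarith
    obtain ⟨X, hX⟩ := eventually_atTop.mp ((hl.eventually_uniform hη0).and
      (hl.2.1.and (eventually_gt_atTop 0)))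
    have hone : ∀ x, X ≤ x → ∀ c ∈ Set.Icc (1 : ℝ) 2,
        (1 - η) * c ^ β * (x ^ β * l x) ≤ (c * x) ^ β * l (c * x) := by
      intro x hx c hc
      have hx0 := (hX x hx).2.2
      have := (hX x hx).1 c hc
      rw [Real.mul_rpow (by linarith [hc.1]) hx0.le]
      have hcx : 0 ≤ c ^ β * x ^ β :=
        mul_nonneg (Real.rpow_nonneg (by linarith [hc.1]) _) (Real.rpow_nonneg hx0.le _)
      nlinarith
    have hpow : ∀ x, X ≤ x → ∀ n : ℕ, x ^ β * l x ≤ (2 ^ n * x) ^ β * l (2 ^ n * x) := by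
      intro x hx n
      have hx0 := (hX x hx).2.2
      induction n with
      | zero => simp
      | succ n ih =>
        have hge : x ≤ 2 ^ n * x := le_mul_of_one_le_left hx0.le (one_le_pow₀ (by norm_num))
        have := hone (2 ^ n * x) (hx.trans hge) 2 (by norm_num)
        have hp : 0 ≤ (2 ^ n * x) ^ β * l (2 ^ n * x) :=
          mul_nonneg (Real.rpow_nonneg (by positivity) _) (hX _ (hx.trans hge)).2.1.le
        rw [← mul_assoc 2, ← pow_succ'] at this
        nlinarith
    filter_upwards [eventually_ge_atTop X] with x hx y hxy
    have hx0 := (hX x hx).2.2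
    obtain ⟨n, hn1, hn2⟩ := exists_nat_pow_near (x := y / x) (y := 2)
      (by rwa [le_div_iff₀ hx0, one_mul]) (by norm_num)
    have hge : x ≤ 2 ^ n * x := le_mul_of_one_le_left hx0.le (one_le_pow₀ (by norm_num))
    have hc : y / x / 2 ^ n ∈ Set.Icc (1 : ℝ) 2 := by
      constructor
      · rwa [le_div_iff₀ (by positivity), one_mul]
      · rw [div_le_iff₀ (by positivity), ← pow_succ']; exact hn2.le
    have h1 := hone (2 ^ n * x) (hx.trans hge) _ hc
    have h2 : y / x / 2 ^ n * (2 ^ n * x) = y := by field_simp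
    rw [h2] at h1
    have h3 := hpow x hx n
    have h4 : 1 ≤ (y / x / 2 ^ n) ^ β := Real.one_le_rpow hc.1 hβ.le
    have h5 : 0 ≤ x ^ β * l x := mul_nonneg (Real.rpow_nonneg hx0.le _) (hX x hx).2.1.le
    calc (1 - ε) * (x ^ β * l x) ≤ (1 - η) * (x ^ β * l x) := by gcongr
      _ ≤ (1 - η) * (y / x / 2 ^ n) ^ β * ((2 ^ n * x) ^ β * l (2 ^ n * x)) := by
        have : 0 ≤ 1 - η := by linarith
        gcongr
        exact le_mul_of_one_le_right this h4
      _ ≤ _ := h1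

theorem IsSlowlyVarying.tendsto_rpow_mul_div {l : ℝ → ℝ} (hl : IsSlowlyVarying l) (β : ℝ) {c : ℝ}
    (hc : 0 < c) :
    Tendsto (fun x => ((c * x) ^ β * l (c * x)) / (x ^ β * l x)) atTop (𝓝 (c ^ β)) := by
  have h1 := (hl.2.2 c hc).const_mul (c ^ β)
  rw [mul_one] at h1
  refine h1.congr' ?_
  filter_upwards [eventually_gt_atTop 0, hl.2.1] with x hx hlx
  have : 0 < x ^ β := Real.rpow_pos_of_pos hx _
  rw [Real.mul_rpow hc.le hx.le]
  field_simp

/-! ### An Abelian theorem for the Che sum -/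

section Abelian

variable {q p : ℕ → ℝ}

theorem tsum_nat_add_pos_of_ratio (hq0 : ∀ i, 0 ≤ q i) (hqs : Summable q)
    (hev : ∀ᶠ n in atTop, 0 < q n) (y : ℕ) : 0 < ∑' i, q (y + i) := by
  obtain ⟨N, hN⟩ := eventually_atTop.mp hev
  have hs : Summable fun i => q (y + i) := by simpa only [add_comm] using (summable_nat_add_iff y).mpr hqs
  exact hs.tsum_pos (fun i => hq0 _) N (hN _ (by omega))

theorem eventually_pos_of_ratio (hq0 : ∀ i, 0 ≤ q i)
    (hratio : Tendsto (fun n => q n / q (n + 1)) atTop (𝓝 1)) : ∀ᶠ n in atTop, 0 < q n := by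
  filter_upwards [hratio.eventually (lt_mem_nhds zero_lt_one)] with n hn
  exact (hq0 n).lt_of_ne fun h => by simp [← h] at hn

/-- If consecutive terms of a summable sequence are asymptotically equivalent, so are
consecutive tails. -/
theorem tendsto_tail_ratio (hq0 : ∀ i, 0 ≤ q i) (hqs : Summable q)
    (hratio : Tendsto (fun n => q n / q (n + 1)) atTop (𝓝 1)) :
    Tendsto (fun n => (∑' i, q (n + 1 + i)) / ∑' i, q (n + i)) atTop (𝓝 1) := by
  have hev := eventually_pos_of_ratio hq0 hratio
  have hs : ∀ y, Summable fun i => q (y + i) := fun y => by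
    simpa only [add_comm] using (summable_nat_add_iff y).mpr hqs
  have hpos := tsum_nat_add_pos_of_ratio hq0 hqs hev
  have hshift : ∀ j : ℕ, Tendsto (fun n => q (n + j) / q n) atTop (𝓝 1) := by
    intro j
    induction j with
    | zero =>
      refine tendsto_const_nhds.congr' ?_
      filter_upwards [hev] with n hn
      simp [hn.ne']
    | succ j ih =>
      have h1 := (hratio.comp (tendsto_add_atTop_nat j)).inv₀ one_ne_zero
      have h2 := h1.mul ih
      simp only [inv_one, one_mul] at h2
      refine h2.congr' ?_
      filter_upwards [(tendsto_add_atTop_nat j).eventually hev] with n hn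
      simp only [Function.comp]
      rw [inv_div, div_mul_div_cancel₀ hn.ne', add_assoc]
  have hsmall : Tendsto (fun n => q n / ∑' i, q (n + i)) atTop (𝓝 0) := by
    rw [tendsto_order]
    refine ⟨fun a ha => Eventually.of_forall fun n =>
      ha.trans_le (div_nonneg (hq0 n) (hpos n).le), fun a ha => ?_⟩
    -- The next K terms are each equivalent to q n, so their sum eventually exceeds q n / a.
    obtain ⟨K, hK⟩ := exists_nat_gt (a⁻¹)
    have h1 : Tendsto (fun n => ∑ j ∈ Finset.range K, q (n + j) / q n) atTop (𝓝 K) := by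
      simpa using tendsto_finsetSum (Finset.range K) fun j _ => hshift j
    filter_upwards [h1.eventually (lt_mem_nhds hK), hev] with n hn hqn
    rw [← Finset.sum_div, lt_div_iff₀ hqn] at hn
    have h2 := (hs n).sum_le_tsum (Finset.range K) (fun i _ => hq0 _)
    rw [div_lt_iff₀ (hpos n)]
    have h3 := hn.trans_le h2
    rw [inv_mul_lt_iff₀ ha] at h3
    exact h3
  have h1 := hsmall.const_sub 1
  rw [sub_zero] at h1
  refine h1.congr fun n => ?_
  have h2 : ∑' i, q (n + i) = q n + ∑' i, q (n + 1 + i) := by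
    rw [(hs n).tsum_eq_zero_add, add_zero]
    exact congrArg _ (tsum_congr fun i => by congr 1; omega)
  rw [eq_div_iff (hpos n).ne', sub_mul, div_mul_cancel₀ _ (hpos n).ne', h2]
  ring

/-- The weight that `q` gives to the indices with `p i ≤ u`. -/
noncomputable def lowWeight (q p : ℕ → ℝ) (u : ℝ) : ℝ := ∑' i, if p i ≤ u then q i else 0

/-- The Laplace transform `∑ q_i e^{-p_i t}`. -/
noncomputable def laplaceSum (q p : ℕ → ℝ) (t : ℝ) : ℝ := ∑' i, q i * Real.exp (-(p i * t))

theorem summable_lowWeight (hq0 : ∀ i, 0 ≤ q i) (hqs : Summable q) (u : ℝ) :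
    Summable fun i => if p i ≤ u then q i else 0 :=
  hqs.of_nonneg_of_le (fun i => by split_ifs <;> simp [hq0]) fun i => by split_ifs <;> simp [hq0]

theorem lowWeight_mono (hq0 : ∀ i, 0 ≤ q i) (hqs : Summable q) : Monotone (lowWeight q p) := by
  intro u v huv
  refine (summable_lowWeight hq0 hqs u).tsum_le_tsum (fun i => ?_) (summable_lowWeight hq0 hqs v)
  by_cases h : p i ≤ u
  · simp [h, h.trans huv]
  · simp only [h, if_false]; split_ifs <;> simp [hq0]

theorem lowWeight_le (hq0 : ∀ i, 0 ≤ q i) (hqs : Summable q) (u : ℝ) :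
    lowWeight q p u ≤ ∑' i, q i :=
  (summable_lowWeight hq0 hqs u).tsum_le_tsum (fun i => by split_ifs <;> simp [hq0]) hqs

/-- Since p is sorted, the indices with p i ≤ t⁻¹ form a final segment, so the weight is a tail of
q. -/
theorem lowWeight_inv_eq (hq0 : ∀ i, 0 ≤ q i) (hqs : Summable q) (hp : Antitone p)
    (hplim : Tendsto p atTop (𝓝 0)) {t : ℝ} (ht : 0 < t) :
    lowWeight q p t⁻¹ = ∑' i, q (sInf {y | p y ≤ t⁻¹} + i) := by
  have hne : {y | p y ≤ t⁻¹}.Nonempty :=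
    (hplim.eventually (ge_mem_nhds (inv_pos.mpr ht))).exists
  have hmem := Nat.sInf_mem hne
  set Y := sInf {y | p y ≤ t⁻¹}
  have hlt : ∀ i < Y, ¬ p i ≤ t⁻¹ := fun i hi => Nat.notMem_of_lt_sInf hi
  unfold lowWeight
  rw [← (summable_lowWeight hq0 hqs t⁻¹).sum_add_tsum_nat_add Y,
    Finset.sum_eq_zero fun i hi => if_neg (hlt i (Finset.mem_range.mp hi)), zero_add]
  refine tsum_congr fun i => ?_
  rw [if_pos ((hp (by omega : Y ≤ i + Y)).trans hmem), add_comm]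

theorem tendsto_sInf_index (hp : Antitone p) (hp0 : ∀ i, 0 < p i)
    (hplim : Tendsto p atTop (𝓝 0)) :
    Tendsto (fun t : ℝ => sInf {y | p y ≤ t⁻¹}) atTop atTop := by
  rw [tendsto_atTop]
  intro N
  filter_upwards [eventually_gt_atTop (p N)⁻¹] with t ht
  have ht0 : 0 < t := (inv_pos.mpr (hp0 N)).trans ht
  have hne : {y | p y ≤ t⁻¹}.Nonempty :=
    (hplim.eventually (ge_mem_nhds (inv_pos.mpr ht0))).exists
  by_contra! hlt
  have h1 : p (sInf {y | p y ≤ t⁻¹}) ≤ t⁻¹ := Nat.sInf_mem hne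
  have h2 := hp hlt.le
  have h3 := inv_lt_of_inv_lt₀ (hp0 N) ht
  linarith

/-- The weight near zero is equivalent to `1 / F`, when this holds at the points `p y` and `F` is
almost increasing. -/
theorem tendsto_lowWeight_inv_mul {F : ℝ → ℝ} (hq0 : ∀ i, 0 ≤ q i) (hqs : Summable q)
    (hratio : Tendsto (fun n => q n / q (n + 1)) atTop (𝓝 1))
    (hp : Antitone p) (hp0 : ∀ i, 0 < p i) (hplim : Tendsto p atTop (𝓝 0))
    (hF : ∀ ε > 0, ∀ᶠ x in atTop, ∀ y, x ≤ y → (1 - ε) * F x ≤ F y)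
    (hQF : Tendsto (fun y : ℕ => (∑' i, q (y + i)) * F (p y)⁻¹) atTop (𝓝 1)) :
    Tendsto (fun t => lowWeight q p t⁻¹ * F t) atTop (𝓝 1) := by
  have hev := eventually_pos_of_ratio hq0 hratio
  have hpos := tsum_nat_add_pos_of_ratio hq0 hqs hev
  have hpinv : Tendsto (fun y => (p y)⁻¹) atTop atTop :=
    Tendsto.inv_tendsto_nhdsGT_zero (tendsto_nhdsWithin_iff.mpr
      ⟨hplim, Eventually.of_forall fun i => hp0 i⟩)
  have hY := tendsto_sInf_index hp hp0 hplim
  have hYpred : Tendsto (fun t : ℝ => sInf {y | p y ≤ t⁻¹} - 1) atTop atTop :=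
    (tendsto_sub_atTop_nat 1).comp hY
  have hup := hQF.comp hY
  have hlow : Tendsto (fun y : ℕ => (∑' i, q (y + 1 + i)) * F (p y)⁻¹) atTop (𝓝 1) := by
    have := (tendsto_tail_ratio hq0 hqs hratio).mul hQF
    rw [one_mul] at this
    refine this.congr fun y => ?_
    rw [← mul_assoc, div_mul_cancel₀ _ (hpos y).ne']
  have hlow' := hlow.comp hYpred
  rw [tendsto_order]
  -- If Y is the first index with p Y ≤ t⁻¹, then t lies between 1/p (Y - 1) and 1/p Y. Almost
  -- monotonicity compares F t with F at the left end for the lower bound and at the right end for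
  -- the upper one. The left end pairs F at Y - 1 with the tail from Y, which is why `hlow` shifts
  -- the tail by one.
  constructor
  · intro a ha
    obtain ⟨ε, hε0, hε⟩ : ∃ ε : ℝ, 0 < ε ∧ a < (1 - ε) * 1 ∧ 0 < 1 - ε := by
      refine ⟨min (1 / 2) ((1 - a) / 2), lt_min (by norm_num) (by linarith), ?_, ?_⟩
      · have := min_le_right (1 / 2) ((1 - a) / 2); linarith
      · have := min_le_left (1 / 2) ((1 - a) / 2); linarith
    filter_upwards [(hlow'.const_mul (1 - ε)).eventually (lt_mem_nhds hε.1),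
      hYpred.eventually (hpinv.eventually (hF ε hε0)), eventually_gt_atTop 0,
      hY.eventually (eventually_ge_atTop 1)] with t h1 h2 ht h3
    refine h1.trans_le ?_
    have hlt : t⁻¹ < p (sInf {y | p y ≤ t⁻¹} - 1) := by
      have : ¬ p (sInf {y | p y ≤ t⁻¹} - 1) ≤ t⁻¹ :=
        Nat.notMem_of_lt_sInf (s := {y | p y ≤ t⁻¹}) (by omega)
      linarith
    have h4 := h2 t (inv_le_of_inv_le₀ ht hlt.le)
    rw [lowWeight_inv_eq hq0 hqs hp hplim ht]
    simp only [Function.comp]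
    rw [Nat.sub_add_cancel h3, mul_left_comm]
    exact mul_le_mul_of_nonneg_left h4 (hpos _).le
  · intro b hb
    obtain ⟨ε, hε0, hε1, hε⟩ : ∃ ε : ℝ, 0 < ε ∧ ε < 1 ∧ 1 < (1 - ε) * b := by
      refine ⟨(b - 1) / (2 * b), by apply div_pos <;> linarith, ?_, ?_⟩
      · rw [div_lt_one (by linarith)]; linarith
      · have : (1 - (b - 1) / (2 * b)) * b = (b + 1) / 2 := by
          have : b ≠ 0 := by linarith
          field_simp; ring
        linarith
    filter_upwards [hup.eventually (gt_mem_nhds hε), hF ε hε0, eventually_gt_atTop 0]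
      with t h1 h2 ht
    have hne : {y | p y ≤ t⁻¹}.Nonempty :=
      (hplim.eventually (ge_mem_nhds (inv_pos.mpr ht))).exists
    have hle : p (sInf {y | p y ≤ t⁻¹}) ≤ t⁻¹ := Nat.sInf_mem hne
    have h3 := h2 _ ((le_inv_comm₀ ht (hp0 _)).mpr hle)
    rw [lowWeight_inv_eq hq0 hqs hp hplim ht]
    simp only [Function.comp] at h1
    have h4 := mul_le_mul_of_nonneg_left h3 (hpos (sInf {y | p y ≤ t⁻¹})).le
    rw [mul_left_comm] at h4
    exact lt_of_mul_lt_mul_left (h4.trans_lt h1) (by linarith)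

/-- Write each e^{-p_i t} as the integral of e^{-v} over v ≥ p_i t and exchange sum and integral;
the items with p_i ≤ v/t remain. -/
theorem laplaceSum_eq_integral (hq0 : ∀ i, 0 ≤ q i) (hqs : Summable q) (hp0 : ∀ i, 0 < p i)
    {t : ℝ} (ht : 0 < t) :
    laplaceSum q p t = ∫ v in Set.Ioi (0 : ℝ), Real.exp (-v) * lowWeight q p (v * t⁻¹) := by
  set f : ℕ → ℝ → ℝ := fun i => (Set.Ici (p i * t)).indicator fun v => q i * Real.exp (-v)
  have hexp : ∀ a : ℝ, IntegrableOn (fun v : ℝ => Real.exp (-v)) (Set.Ioi a) := fun a => by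
    simpa using integrableOn_exp_mul_Ioi (a := -1) (by norm_num) a
  have hint : ∀ i, Integrable (f i) (volume.restrict (Set.Ioi 0)) := fun i =>
    ((hexp 0).const_mul (q i)).indicator measurableSet_Ici
  have hval : ∀ i, ∫ v in Set.Ioi (0 : ℝ), f i v = q i * Real.exp (-(p i * t)) := by
    intro i
    have hpt : 0 < p i * t := mul_pos (hp0 i) ht
    rw [setIntegral_indicator measurableSet_Ici,
      Set.inter_eq_right.mpr (Set.Ici_subset_Ioi.mpr hpt), integral_Ici_eq_integral_Ioi,
      integral_const_mul, integral_exp_neg_Ioi]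
  have hnn : ∀ i v, 0 ≤ f i v := fun i v =>
    Set.indicator_nonneg (fun v _ => mul_nonneg (hq0 i) (Real.exp_pos _).le) v
  have hsum := hasSum_integral_of_summable_integral_norm hint (by
    simp only [Real.norm_of_nonneg (hnn _ _), hval]
    exact hqs.of_nonneg_of_le (fun i => mul_nonneg (hq0 i) (Real.exp_pos _).le) fun i =>
      mul_le_of_le_one_right (hq0 i) (Real.exp_le_one_iff.mpr
        (neg_nonpos.mpr (mul_pos (hp0 i) ht).le)))
  simp only [hval] at hsum
  unfold laplaceSum
  rw [hsum.tsum_eq]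
  congr 1
  ext v
  unfold lowWeight
  rw [← tsum_mul_left]
  refine tsum_congr fun i => ?_
  simp only [f, Set.indicator, Set.mem_Ici, ← div_eq_mul_inv, le_div_iff₀ ht]
  split_ifs <;> simp [mul_comm]

theorem lowWeight_pos (hq0 : ∀ i, 0 ≤ q i) (hqs : Summable q)
    (hev : ∀ᶠ n in atTop, 0 < q n) (hplim : Tendsto p atTop (𝓝 0)) {u : ℝ} (hu : 0 < u) :
    0 < lowWeight q p u := by
  obtain ⟨n, hn, hpn⟩ := (hev.and (hplim.eventually (ge_mem_nhds hu))).exists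
  exact (summable_lowWeight hq0 hqs u).tsum_pos (fun i => by split_ifs <;> simp [hq0]) n
    (by simp [hpn, hn])

/-- If `lowWeight` is regularly varying at zero, it satisfies a doubling condition. -/
theorem exists_lowWeight_two_mul_le {β : ℝ} (hq0 : ∀ i, 0 ≤ q i) (hqs : Summable q)
    (hev : ∀ᶠ n in atTop, 0 < q n) (hplim : Tendsto p atTop (𝓝 0))
    (hreg : ∀ c > 0, Tendsto (fun t => lowWeight q p (c * t⁻¹) / lowWeight q p t⁻¹) atTop
      (𝓝 (c ^ β))) :
    ∃ a : ℕ, ∀ u > 0, lowWeight q p (2 * u) ≤ 2 ^ a * lowWeight q p u := by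
  have hpos : ∀ {u : ℝ}, 0 < u → 0 < lowWeight q p u := lowWeight_pos hq0 hqs hev hplim
  have hmono := lowWeight_mono (p := p) hq0 hqs
  obtain ⟨t₀, ht₀, ht₀'⟩ := ((eventually_forall_ge_atTop.mpr ((hreg 2 two_pos).eventually
    (gt_mem_nhds (lt_add_one (2 ^ β))))).and (eventually_gt_atTop 0)).exists
  obtain ⟨a, ha⟩ := pow_unbounded_of_one_lt
    (max (2 ^ β + 1) ((∑' i, q i) / lowWeight q p t₀⁻¹)) one_lt_two
  refine ⟨a, fun u hu => ?_⟩
  -- Regular variation gives the doubling constant for small u; for larger u the weight is at most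
  -- the total mass and at least its value at t₀⁻¹.
  rcases le_total t₀ u⁻¹ with h | h
  · have h1 := (ht₀ _ h).le.trans ((le_max_left _ _).trans ha.le)
    rwa [inv_inv, div_le_iff₀ (hpos hu)] at h1
  · have h1 := (le_max_right (2 ^ β + 1) ((∑' i, q i) / lowWeight q p t₀⁻¹)).trans ha.le
    rw [div_le_iff₀ (hpos (inv_pos.mpr ht₀'))] at h1
    refine (lowWeight_le hq0 hqs _).trans (h1.trans ?_)
    have := hmono (inv_le_of_inv_le₀ hu h)
    gcongr

/-- Iterated doubling gives polynomial growth, with (2v)^a because v is rounded up to a power of 2;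
the summand 1 covers v ≤ 1. This supplies the dominating function of the Abelian theorem. -/
theorem lowWeight_mul_le {a : ℕ} (hq0 : ∀ i, 0 ≤ q i) (hqs : Summable q)
    (ha : ∀ u > 0, lowWeight q p (2 * u) ≤ 2 ^ a * lowWeight q p u) {u v : ℝ} (hu : 0 < u)
    (hv : 0 < v) : lowWeight q p (v * u) ≤ (1 + (2 * v) ^ a) * lowWeight q p u := by
  have hmono := lowWeight_mono (p := p) hq0 hqs
  have hnn : 0 ≤ lowWeight q p u := tsum_nonneg fun i => by split_ifs <;> simp [hq0]
  have hpow : ∀ n : ℕ, lowWeight q p (2 ^ n * u) ≤ (2 ^ n) ^ a * lowWeight q p u := by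
    intro n
    induction n with
    | zero => simp
    | succ n ih =>
      rw [pow_succ', mul_assoc, mul_pow, mul_assoc]
      refine (ha _ (by positivity)).trans ?_
      gcongr
  rcases le_total v 1 with h | h
  · refine (hmono (mul_le_of_le_one_left hu.le h)).trans ?_
    have : 0 ≤ (2 * v) ^ a * lowWeight q p u := by positivity
    linarith
  · obtain ⟨n, hn1, hn2⟩ := exists_nat_pow_near h one_lt_two
    calc lowWeight q p (v * u) ≤ lowWeight q p (2 ^ (n + 1) * u) := hmono (by gcongr)
      _ ≤ (2 ^ (n + 1)) ^ a * lowWeight q p u := hpow _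
      _ ≤ (2 * v) ^ a * lowWeight q p u := by rw [pow_succ']; gcongr
      _ ≤ _ := by linarith

theorem integrableOn_exp_neg_mul_one_add_pow (a : ℕ) :
    IntegrableOn (fun v : ℝ => Real.exp (-v) * (1 + (2 * v) ^ a)) (Set.Ioi 0) := by
  have h1 := Real.GammaIntegral_convergent (s := 1) one_pos
  have h2 := (Real.GammaIntegral_convergent (s := a + 1) (by positivity)).mul_const (2 ^ a)
  refine (h1.add h2).congr (ae_of_all _ fun v => ?_)
  simp only [Pi.add_apply, sub_self, Real.rpow_zero, add_sub_cancel_right, Real.rpow_natCast,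
    mul_pow]
  ring

theorem tendsto_lowWeight_ratio {F : ℝ → ℝ} {β : ℝ} (hq0 : ∀ i, 0 ≤ q i)
    (hqs : Summable q) (hev : ∀ᶠ n in atTop, 0 < q n)
    (hplim : Tendsto p atTop (𝓝 0)) (hFpos : ∀ᶠ t in atTop, 0 < F t)
    (hFreg : ∀ c > 0, Tendsto (fun t => F (c * t) / F t) atTop (𝓝 (c ^ β)))
    (hG : Tendsto (fun t => lowWeight q p t⁻¹ * F t) atTop (𝓝 1)) :
    ∀ c > 0, Tendsto (fun t => lowWeight q p (c * t⁻¹) / lowWeight q p t⁻¹) atTop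
      (𝓝 (c ^ β)) := by
  have hpos : ∀ {u : ℝ}, 0 < u → 0 < lowWeight q p u := lowWeight_pos hq0 hqs hev hplim
  intro c hc
  have hct : Tendsto (fun t : ℝ => c⁻¹ * t) atTop atTop :=
    tendsto_id.const_mul_atTop (inv_pos.mpr hc)
  have h1 := ((hG.comp hct).div hG one_ne_zero).div (hFreg c⁻¹ (inv_pos.mpr hc))
    (Real.rpow_pos_of_pos (inv_pos.mpr hc) _).ne'
  rw [div_one, one_div, Real.inv_rpow hc.le, inv_inv] at h1
  refine h1.congr' ?_
  filter_upwards [hFpos, hct.eventually hFpos, eventually_gt_atTop 0] with t h2 h3 ht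
  have h4 := (hpos (inv_pos.mpr ht)).ne'
  have h2 := h2.ne'
  have h3 := h3.ne'
  simp only [Function.comp, Pi.div_apply, mul_inv, inv_inv]
  generalize F (c⁻¹ * t) = A at *
  generalize lowWeight q p t⁻¹ = B at *
  field_simp

/-- The Abelian theorem for the Laplace transform of a regularly varying weight. -/
theorem tendsto_laplaceSum_mul {F : ℝ → ℝ} {β : ℝ} (hβ : 0 ≤ β) (hq0 : ∀ i, 0 ≤ q i)
    (hqs : Summable q) (hev : ∀ᶠ n in atTop, 0 < q n) (hp0 : ∀ i, 0 < p i)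
    (hplim : Tendsto p atTop (𝓝 0)) (hFpos : ∀ᶠ t in atTop, 0 < F t)
    (hFreg : ∀ c > 0, Tendsto (fun t => F (c * t) / F t) atTop (𝓝 (c ^ β)))
    (hG : Tendsto (fun t => lowWeight q p t⁻¹ * F t) atTop (𝓝 1)) :
    Tendsto (fun t => laplaceSum q p t * F t) atTop (𝓝 (Real.Gamma (1 + β))) := by
  have hpos : ∀ {u : ℝ}, 0 < u → 0 < lowWeight q p u := lowWeight_pos hq0 hqs hev hplim
  have hmono := lowWeight_mono (p := p) hq0 hqs
  have hreg := tendsto_lowWeight_ratio hq0 hqs hev hplim hFpos hFreg hG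
  obtain ⟨a, ha⟩ := exists_lowWeight_two_mul_le hq0 hqs hev hplim hreg
  have hlim : Tendsto (fun t => ∫ v in Set.Ioi (0 : ℝ),
      Real.exp (-v) * (lowWeight q p (v * t⁻¹) / lowWeight q p t⁻¹)) atTop
      (𝓝 (∫ v in Set.Ioi (0 : ℝ), Real.exp (-v) * v ^ β)) := by
    refine tendsto_integral_filter_of_dominated_convergence _ ?_ ?_
      (integrableOn_exp_neg_mul_one_add_pow a) ?_
    · refine Eventually.of_forall fun t => Measurable.aestronglyMeasurable ?_
      exact (Real.measurable_exp.comp measurable_neg).mul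
        ((hmono.measurable.comp (measurable_mul_const _)).div_const _)
    · filter_upwards [eventually_gt_atTop 0] with t ht
      filter_upwards [ae_restrict_mem measurableSet_Ioi] with v hv
      have ht' := inv_pos.mpr ht
      rw [Real.norm_of_nonneg (mul_nonneg (Real.exp_pos _).le
        (div_nonneg (hpos (mul_pos hv ht')).le (hpos ht').le))]
      gcongr
      rw [div_le_iff₀ (hpos ht')]
      exact lowWeight_mul_le hq0 hqs ha ht' hv
    · filter_upwards [ae_restrict_mem measurableSet_Ioi] with v hv
      exact (hreg v hv).const_mul _
  rw [Real.Gamma_eq_integral (by linarith), add_sub_cancel_left]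
  have h1 := hlim.mul hG
  rw [mul_one] at h1
  refine h1.congr' ?_
  filter_upwards [eventually_gt_atTop 0] with t ht
  have h4 := (hpos (inv_pos.mpr ht)).ne'
  rw [laplaceSum_eq_integral hq0 hqs hp0 ht]
  simp only [← mul_div_assoc]
  rw [integral_div]
  generalize lowWeight q p t⁻¹ = B at *
  field_simp

theorem summable_laplaceSum (hq0 : ∀ i, 0 ≤ q i) (hqs : Summable q) (hp0 : ∀ i, 0 ≤ p i) {t : ℝ}
    (ht : 0 ≤ t) : Summable fun i => q i * Real.exp (-(p i * t)) :=
  hqs.of_nonneg_of_le (fun i => mul_nonneg (hq0 i) (Real.exp_pos _).le) fun i =>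
    mul_le_of_le_one_right (hq0 i)
      (Real.exp_le_one_iff.mpr (neg_nonpos.mpr (mul_nonneg (hp0 i) ht)))

theorem laplaceSum_antitoneOn (hq0 : ∀ i, 0 ≤ q i) (hqs : Summable q) (hp0 : ∀ i, 0 ≤ p i) :
    AntitoneOn (laplaceSum q p) (Set.Ici 0) := by
  intro s hs t ht hst
  refine (summable_laplaceSum hq0 hqs hp0 ht).tsum_le_tsum (fun i => ?_)
    (summable_laplaceSum hq0 hqs hp0 hs)
  have := hp0 i
  have := hq0 i
  gcongr

theorem laplaceSum_pos (hq0 : ∀ i, 0 ≤ q i) (hqs : Summable q) (hp0 : ∀ i, 0 ≤ p i)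
    (hev : ∀ᶠ n in atTop, 0 < q n) {t : ℝ} (ht : 0 ≤ t) : 0 < laplaceSum q p t := by
  obtain ⟨n, hn⟩ := hev.exists
  exact (summable_laplaceSum hq0 hqs hp0 ht).tsum_pos
    (fun i => mul_nonneg (hq0 i) (Real.exp_pos _).le) n (mul_pos hn (Real.exp_pos _))

/-- A Laplace transform with regularly varying weight decays at most polynomially. -/
theorem exists_le_pow_mul_laplaceSum {β : ℝ} (hq0 : ∀ i, 0 ≤ q i) (hqs : Summable q)
    (hev : ∀ᶠ n in atTop, 0 < q n) (hp0 : ∀ i, 0 ≤ p i) (hplim : Tendsto p atTop (𝓝 0))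
    (hreg : ∀ c > 0, Tendsto (fun t => lowWeight q p (c * t⁻¹) / lowWeight q p t⁻¹) atTop
      (𝓝 (c ^ β))) :
    ∃ a : ℕ, ∃ c > 0, ∀ t, 1 ≤ t → c ≤ t ^ a * laplaceSum q p t := by
  obtain ⟨a, ha⟩ := exists_lowWeight_two_mul_le hq0 hqs hev hplim hreg
  have h1 := lowWeight_pos hq0 hqs hev hplim (u := 1) one_pos
  refine ⟨a, Real.exp (-1) * lowWeight q p 1 / (2 * 2 ^ a), by positivity, fun t ht => ?_⟩
  have ht0 : 0 < t := by linarith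
  have h2 := lowWeight_mul_le hq0 hqs ha (inv_pos.mpr ht0) ht0
  rw [mul_inv_cancel₀ ht0.ne'] at h2
  -- On the items with p_i ≤ 1/t the exponential is at least e^{-1}, so the transform dominates the
  -- weight, whose decay is limited by doubling.
  have h3 : Real.exp (-1) * lowWeight q p t⁻¹ ≤ laplaceSum q p t := by
    unfold lowWeight laplaceSum
    rw [← tsum_mul_left]
    refine ((summable_lowWeight hq0 hqs _).mul_left _).tsum_le_tsum (fun i => ?_)
      (summable_laplaceSum hq0 hqs hp0 ht0.le)
    split_ifs with h
    · rw [mul_comm]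
      refine mul_le_mul_of_nonneg_left (Real.exp_le_exp.mpr (neg_le_neg ?_)) (hq0 i)
      rwa [← le_div_iff₀ ht0, one_div]
    · rw [mul_zero]
      exact mul_nonneg (hq0 i) (Real.exp_pos _).le
  have h4 : 1 ≤ (2 * t) ^ a := one_le_pow₀ (by linarith)
  have h5 : 0 < lowWeight q p t⁻¹ := lowWeight_pos hq0 hqs hev hplim (inv_pos.mpr ht0)
  rw [div_le_iff₀ (by positivity)]
  calc Real.exp (-1) * lowWeight q p 1
      ≤ Real.exp (-1) * ((1 + (2 * t) ^ a) * lowWeight q p t⁻¹) := by gcongr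
    _ ≤ Real.exp (-1) * (((2 * t) ^ a + (2 * t) ^ a) * lowWeight q p t⁻¹) := by gcongr
    _ = t ^ a * (Real.exp (-1) * lowWeight q p t⁻¹) * (2 * 2 ^ a) := by rw [mul_pow]; ring
    _ ≤ _ := by gcongr

end Abelian

/-! ### Negative dependence for one request -/

section NegativeDependence

/-- The coefficients of `∏ (1 - c d 1[x ≠ d])` all lie in `[0, 1]`, or are all nonpositive: the
factors are nonnegative and monotone in the same direction. -/
def IsOneSided (c : ℕ → ℝ) : Prop := (∀ d, 0 ≤ c d ∧ c d ≤ 1) ∨ ∀ d, c d ≤ 0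

theorem IsOneSided.le_one {c : ℕ → ℝ} (hc : IsOneSided c) (d : ℕ) : c d ≤ 1 := by
  rcases hc with h | h
  · exact (h d).2
  · linarith [h d]

theorem IsOneSided.mul {c w : ℕ → ℝ} (hc : IsOneSided c) (hw : ∀ d, 0 ≤ w d ∧ w d ≤ 1) :
    IsOneSided fun d => c d * w d := by
  rcases hc with h | h
  · exact Or.inl fun d => ⟨mul_nonneg (h d).1 (hw d).1, mul_le_one₀ (h d).2 (hw d).1 (hw d).2⟩
  · exact Or.inr fun d => mul_nonpos_of_nonpos_of_nonneg (h d) (hw d).1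

theorem abs_prod_one_sub_le (A : Finset ℕ) (c w : ℕ → ℝ) (hw : ∀ d, 0 ≤ w d ∧ w d ≤ 1) :
    |∏ d ∈ A, (1 - c d * w d)| ≤ ∏ d ∈ A, (1 + |c d|) := by
  rw [Finset.abs_prod]
  refine Finset.prod_le_prod (fun _ _ => abs_nonneg _) fun d _ => ?_
  refine (abs_sub _ _).trans ?_
  rw [abs_one, abs_mul, abs_of_nonneg (hw d).1]
  have := mul_le_of_le_one_right (abs_nonneg (c d)) (hw d).2
  linarith

theorem ite_eq_mem_unit (x d : ℕ) : 0 ≤ (if x = d then (0 : ℝ) else 1) ∧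
    (if x = d then (0 : ℝ) else 1) ≤ 1 := by
  split_ifs <;> norm_num

/-- Negative dependence of the indicators of the atoms for a single sample. -/
theorem integral_prod_one_sub_le (ν : Measure ℕ) [IsProbabilityMeasure ν] {c : ℕ → ℝ}
    (hc : IsOneSided c) (A : Finset ℕ) :
    ∫ x, ∏ d ∈ A, (1 - c d * if x = d then 0 else 1) ∂ν ≤
      ∏ d ∈ A, (1 - c d * (1 - ν.real {d})) := by
  have hint : ∀ A : Finset ℕ, Integrable (fun x => ∏ d ∈ A, (1 - c d * if x = d then 0 else 1)) ν :=
    fun A => Integrable.of_bound Measurable.of_discrete.aestronglyMeasurable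
      (∏ d ∈ A, (1 + |c d|)) (ae_of_all _ fun x => abs_prod_one_sub_le A c _ (ite_eq_mem_unit x))
  have hν : ∀ d, 0 ≤ 1 - ν.real {d} ∧ 1 - ν.real {d} ≤ 1 := fun d =>
    ⟨by linarith [measureReal_le_one (μ := ν) (s := {d})],
      by linarith [measureReal_nonneg (μ := ν) (s := {d})]⟩
  have hfac : ∀ w : ℕ → ℝ, (∀ d, 0 ≤ w d ∧ w d ≤ 1) → ∀ d, 0 ≤ 1 - c d * w d := fun w hw d => by
    linarith [(hc.mul hw).le_one d]
  induction A using Finset.induction_on with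
  | empty => simp
  | insert e A he ih =>
    set F : ℕ → ℝ := fun x => ∏ d ∈ A, (1 - c d * if x = d then 0 else 1)
    have hFe : F e = ∏ d ∈ A, (1 - c d) := Finset.prod_congr rfl fun d hd => by
      rw [if_neg (by rintro rfl; exact he hd), mul_one]
    -- When x = e, every indicator x ≠ d with d in A equals 1, so F e is the minimum of F if the
    -- coefficients are nonnegative and its maximum if they are nonpositive. Multiplying by c e
    -- gives the same inequality in both cases.
    have hcF : c e * F e ≤ c e * ∫ x, F x ∂ν := by
      rcases hc with h | h
      · refine mul_le_mul_of_nonneg_left ?_ (h e).1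
        have := integral_mono (integrable_const (F e)) (hint A) (μ := ν) (fun x => by
          simp only [hFe, F]
          refine Finset.prod_le_prod (fun d _ => by linarith [(h d).2]) fun d _ => ?_
          have := (h d).1
          split_ifs <;> linarith)
        rwa [integral_const, probReal_univ, one_smul] at this
      · refine mul_le_mul_of_nonpos_left ?_ (h e)
        have := integral_mono (hint A) (integrable_const (F e)) (μ := ν) (fun x => by
          simp only [hFe, F]
          refine Finset.prod_le_prod (fun d _ => hfac _ (ite_eq_mem_unit x) d) fun d _ => ?_
          have := h d
          split_ifs <;> linarith)
        rwa [integral_const, probReal_univ, one_smul] at this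
    have hsplit : ∀ x, ∏ d ∈ insert e A, (1 - c d * if x = d then 0 else 1) =
        (1 - c e) * F x + c e * (({e} : Set ℕ).indicator (fun _ => F e) x) := by
      intro x
      rw [Finset.prod_insert he]
      by_cases hx : x = e
      · subst hx; simp [F]; ring
      · simp [hx, F]
    have hind : Integrable (({e} : Set ℕ).indicator fun _ => F e) ν :=
      (integrable_const _).indicator (MeasurableSet.singleton e)
    simp only [hsplit]
    rw [integral_add ((hint A).const_mul _) (hind.const_mul _), integral_const_mul,
      integral_const_mul, integral_indicator_const _ (MeasurableSet.singleton e), smul_eq_mul,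
      Finset.prod_insert he]
    have h1 := mul_le_mul_of_nonneg_left hcF (measureReal_nonneg (μ := ν) (s := {e}))
    have h2 := mul_le_mul_of_nonneg_left ih (hfac _ hν e)
    nlinarith

end NegativeDependence

/-! ### The set of items hit by past requests -/

/-- Fubini under independence: the newest variable is integrated out while the others are frozen,
which drives the induction on the number of requests. -/
theorem integral_comp_of_indepFun {Ω α β : Type*} [MeasurableSpace Ω] [MeasurableSpace α]
    [MeasurableSpace β] [Countable α] [Countable β] [MeasurableSingletonClass α]
    [MeasurableSingletonClass β] {P : Measure Ω} [IsProbabilityMeasure P] {X : Ω → α} {Y : Ω → β}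
    (hX : Measurable X) (hY : Measurable Y) (h : IndepFun X Y P) {Φ : α → β → ℝ} {C : ℝ}
    (hC : ∀ x y, |Φ x y| ≤ C) :
    ∫ ω, Φ (X ω) (Y ω) ∂P = ∫ ω, ∫ x, Φ x (Y ω) ∂(P.map X) ∂P := by
  have hXp : IsProbabilityMeasure (P.map X) := Measure.isProbabilityMeasure_map hX.aemeasurable
  have hYp : IsProbabilityMeasure (P.map Y) := Measure.isProbabilityMeasure_map hY.aemeasurable
  have hprod := (indepFun_iff_map_prod_eq_prod_map_map hX.aemeasurable hY.aemeasurable).mp h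
  have hmeas : Measurable fun z : α × β => Φ z.1 z.2 := Measurable.of_discrete
  have h1 := integral_map (μ := P) (hX.prodMk hY).aemeasurable
    (f := fun z : α × β => Φ z.1 z.2) hmeas.aestronglyMeasurable
  rw [← h1, hprod, integral_prod_symm _ (Integrable.of_bound hmeas.aestronglyMeasurable C
    (ae_of_all _ fun z => hC z.1 z.2)), integral_map hY.aemeasurable
    Measurable.of_discrete.aestronglyMeasurable]

section Hits

variable {Ω : Type*}

/-- The set of items requested at the times `-n, …, -1`. -/
noncomputable def hits (R : ℤ → Ω → ℕ) (n : ℕ) (ω : Ω) : Finset ℕ :=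
  (Finset.Ico (-(n : ℤ)) 0).image fun j => R j ω

theorem mem_hits {R : ℤ → Ω → ℕ} {n : ℕ} {ω : Ω} {d : ℕ} :
    d ∈ hits R n ω ↔ ∃ j : ℤ, (-n ≤ j ∧ j < 0) ∧ R j ω = d := by
  simp [hits]

theorem mem_hits_succ {R : ℤ → Ω → ℕ} {n : ℕ} {ω : Ω} {d : ℕ} :
    d ∈ hits R (n + 1) ω ↔ R (-(n + 1 : ℕ)) ω = d ∨ d ∈ hits R n ω := by
  have : Finset.Ico (-((n + 1 : ℕ) : ℤ)) 0 =
      insert (-((n + 1 : ℕ) : ℤ)) (Finset.Ico (-(n : ℤ)) 0) := by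
    ext j; simp only [Finset.mem_Ico, Finset.mem_insert]; omega
  rw [hits, this, Finset.image_insert, Finset.mem_insert, eq_comm, hits]

theorem hits_eq_image_univ (R : ℤ → Ω → ℕ) (n : ℕ) (ω : Ω) :
    hits R n ω = Finset.univ.image (fun j : Finset.Ico (-(n : ℤ)) 0 => R j ω) := by
  ext d
  simp [hits]

variable [MeasurableSpace Ω] {P : Measure Ω}

theorem measurableSet_hits {R : ℤ → Ω → ℕ} (hR : ∀ j, Measurable (R j)) (n : ℕ)
    (B : Set (Finset ℕ)) : MeasurableSet {ω | hits R n ω ∈ B} := by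
  have hY : Measurable fun ω (j : Finset.Ico (-(n : ℤ)) 0) => R j ω :=
    measurable_pi_lambda _ fun j => hR j
  simp only [hits_eq_image_univ]
  exact hY (MeasurableSet.of_discrete (s := {y | Finset.univ.image y ∈ B}))

theorem measurable_comp_hits {R : ℤ → Ω → ℕ} (hR : ∀ j, Measurable (R j)) (n : ℕ)
    {α : Type*} [MeasurableSpace α] (g : Finset ℕ → α) : Measurable fun ω => g (hits R n ω) :=
  fun B _ => measurableSet_hits hR n (g ⁻¹' B)

theorem indepFun_tuple {α : Type*} [MeasurableSpace α] {Z : ℤ → Ω → α} (hZ : ∀ j, Measurable (Z j))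
    (hind : iIndepFun Z P) {φ : α → ℕ} (hφ : Measurable φ) {m : ℤ} {T : Finset ℤ} (hm : m ∉ T) :
    IndepFun (Z m) (fun ω (j : T) => φ (Z j ω)) P := by
  have h := hind.indepFun_finset {m} T (by simpa using hm) hZ
  have h1 : Measurable fun z : ({m} : Finset ℤ) → α => z ⟨m, Finset.mem_singleton_self m⟩ :=
    measurable_pi_apply _
  have h2 : Measurable fun (z : T → α) (j : T) => φ (z j) :=
    measurable_pi_lambda _ fun j => hφ.comp (measurable_pi_apply j)
  exact h.comp h1 h2

theorem prob_notMem_hits [IsProbabilityMeasure P] {R : ℤ → Ω → ℕ} (hR : ∀ j, Measurable (R j))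
    (hind : iIndepFun R P) {d : ℕ} {x : ℝ} (hlaw : ∀ j, P.real {ω | R j ω = d} = x) (n : ℕ) :
    P.real {ω | d ∉ hits R n ω} = (1 - x) ^ n := by
  have h1 : {ω | d ∉ hits R n ω} = ⋂ j ∈ Finset.Ico (-(n : ℤ)) 0, R j ⁻¹' {d}ᶜ := by
    ext ω
    simp [mem_hits]
  rw [h1, measureReal_def, hind.measure_inter_preimage_eq_mul _
    (fun i _ => (MeasurableSet.singleton d).compl), ENNReal.toReal_prod]
  have h2 : ∀ j, (P (R j ⁻¹' {d}ᶜ)).toReal = 1 - x := fun j => by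
    rw [← hlaw j, Set.preimage_compl, ← measureReal_def,
      probReal_compl_eq_one_sub (hR j (MeasurableSet.singleton d))]
    rfl
  simp only [h2]
  simp

/-- Negative dependence of the set of items hit by independent requests. -/
theorem integral_prod_hits_le [IsProbabilityMeasure P] {R : ℤ → Ω → ℕ}
    (hR : ∀ j, Measurable (R j)) (hind : iIndepFun R P) {p : ℕ → ℝ}
    (hlaw : ∀ j d, P.real {ω | R j ω = d} = p d) (A : Finset ℕ) (n : ℕ) :
    ∀ {c : ℕ → ℝ}, IsOneSided c →
    ∫ ω, ∏ d ∈ A, (1 - c d * if d ∈ hits R n ω then 0 else 1) ∂P ≤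
      ∏ d ∈ A, (1 - c d * (1 - p d) ^ n) := by
  have hw : ∀ (H : Finset ℕ) (d : ℕ), 0 ≤ (if d ∈ H then (0 : ℝ) else 1) ∧
      (if d ∈ H then (0 : ℝ) else 1) ≤ 1 := fun H d => by split_ifs <;> norm_num
  have hp : ∀ d, 0 ≤ 1 - p d ∧ 1 - p d ≤ 1 := fun d =>
    ⟨by rw [← hlaw 0 d]; linarith [measureReal_le_one (μ := P) (s := {ω | R 0 ω = d})],
      by rw [← hlaw 0 d]; linarith [measureReal_nonneg (μ := P) (s := {ω | R 0 ω = d})]⟩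
  induction n with
  | zero => intro c _; simp [hits]
  | succ n ih =>
    intro c hc
    set m : ℤ := -((n + 1 : ℕ) : ℤ) with hm
    have hYm : Measurable fun ω (j : Finset.Ico (-(n : ℤ)) 0) => R j ω :=
      measurable_pi_lambda _ fun j => hR j
    have hindep := indepFun_tuple hR hind measurable_id (m := m) (T := Finset.Ico (-(n : ℤ)) 0)
      (by simp only [Finset.mem_Ico]; omega)
    have hpm : IsProbabilityMeasure (P.map (R m)) :=
      Measure.isProbabilityMeasure_map (hR m).aemeasurable
    have hsplit : ∀ ω, ∏ d ∈ A, (1 - c d * if d ∈ hits R (n + 1) ω then 0 else 1) =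
        ∏ d ∈ A, (1 - (c d * if d ∈ Finset.univ.image
          (fun j : Finset.Ico (-(n : ℤ)) 0 => R j ω) then 0 else 1) *
          if R m ω = d then 0 else 1) := by
      intro ω
      refine Finset.prod_congr rfl fun d _ => ?_
      rw [← hits_eq_image_univ, if_congr mem_hits_succ rfl rfl, hm]
      split_ifs <;> simp_all
    simp only [hsplit]
    rw [integral_comp_of_indepFun (hR m) hYm hindep (Φ := fun x y => ∏ d ∈ A,
      (1 - (c d * if d ∈ Finset.univ.image y then 0 else 1) * if x = d then 0 else 1))
      (C := ∏ d ∈ A, (1 + |c d|)) (fun x y => by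
        simp only [mul_assoc]
        refine abs_prod_one_sub_le A c _ fun d => ?_
        split_ifs <;> norm_num)]
    simp only [← hits_eq_image_univ]
    -- With the other requests frozen, the coefficients c d · 1[d not yet hit] are still one-sided,
    -- so the single-request bound applies. Averaging over request m turns them into c d (1 - p d)
    -- times the indicator, to which the induction hypothesis applies; this is why it quantifies
    -- over c.
    have hc' := hc.mul hp
    refine le_trans (integral_mono ?_ ?_ fun ω =>
      integral_prod_one_sub_le (P.map (R m)) (hc.mul (hw (hits R n ω))) A) ?_
    · refine Integrable.of_bound (measurable_comp_hits hR n fun H => ∫ x, ∏ d ∈ A,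
        (1 - (c d * if d ∈ H then 0 else 1) * if x = d then 0 else 1)
          ∂(P.map (R m))).aestronglyMeasurable (∏ d ∈ A, (1 + |c d|)) (ae_of_all _ fun ω => ?_)
      have := norm_integral_le_of_norm_le_const (μ := P.map (R m)) (C := ∏ d ∈ A, (1 + |c d|))
        (f := fun x => ∏ d ∈ A,
          (1 - (c d * if d ∈ hits R n ω then 0 else 1) * if x = d then 0 else 1))
        (ae_of_all _ fun x => by
          simp only [mul_assoc]
          refine abs_prod_one_sub_le A c _ fun d => ?_
          split_ifs <;> norm_num)
      simpa using this
    · refine Integrable.of_bound (measurable_comp_hits hR n fun H => ∏ d ∈ A,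
        (1 - (c d * if d ∈ H then 0 else 1) * (1 - (P.map (R m)).real {d}))).aestronglyMeasurable
        (∏ d ∈ A, (1 + |c d|)) (ae_of_all _ fun ω => ?_)
      simp only [mul_assoc]
      refine abs_prod_one_sub_le A c _ fun d => ?_
      have h1 := measureReal_nonneg (μ := P.map (R m)) (s := {d})
      have h2 := measureReal_le_one (μ := P.map (R m)) (s := {d})
      split_ifs
      · norm_num
      · constructor <;> linarith
    · have hreal : ∀ d, (P.map (R m)).real {d} = p d := fun d => by
        rw [map_measureReal_apply (hR m) (MeasurableSet.singleton d), ← hlaw m d]; rfl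
      simp only [hreal]
      refine le_trans (le_of_eq ?_) ((ih hc').trans (le_of_eq ?_))
      · congr 1; ext ω; exact Finset.prod_congr rfl fun d _ => by ring
      · exact Finset.prod_congr rfl fun d _ => by ring

end Hits

/-! ### Chernoff bounds for the total size of the hit items -/

section Concentration

theorem exp_neg_one_sub_oneSided {s : ℕ → ℝ} (hs : ∀ d, 0 ≤ s d) (θ : ℝ) :
    IsOneSided fun d => 1 - Real.exp (-(θ * s d)) := by
  rcases le_total 0 θ with h | h
  · refine Or.inl fun d => ⟨?_, by linarith [Real.exp_pos (-(θ * s d))]⟩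
    have : Real.exp (-(θ * s d)) ≤ 1 :=
      Real.exp_le_one_iff.mpr (neg_nonpos.mpr (mul_nonneg h (hs d)))
    linarith
  · refine Or.inr fun d => ?_
    have : 1 ≤ Real.exp (-(θ * s d)) :=
      Real.one_le_exp (neg_nonneg.mpr (mul_nonpos_of_nonpos_of_nonneg h (hs d)))
    linarith

theorem sum_ite_hits_nonneg {Ω : Type*} {R : ℤ → Ω → ℕ} {s : ℕ → ℝ} (hs : ∀ d, 0 ≤ s d)
    (A : Finset ℕ) (n : ℕ) (ω : Ω) : 0 ≤ ∑ d ∈ A, if d ∈ hits R n ω then s d else 0 :=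
  Finset.sum_nonneg fun d _ => by split_ifs <;> simp [hs]

variable {Ω : Type*} [MeasurableSpace Ω] {P : Measure Ω} [IsProbabilityMeasure P]
  {R : ℤ → Ω → ℕ} {p s : ℕ → ℝ} {B : ℝ}

/-- The exponential moments of the total size of the items hit by `n` independent requests. -/
theorem mgf_size_hits_le (hR : ∀ j, Measurable (R j)) (hind : iIndepFun R P)
    (hlaw : ∀ j d, P.real {ω | R j ω = d} = p d) (hs : ∀ d, 0 ≤ s d) (hsB : ∀ d, s d ≤ B)
    (A : Finset ℕ) (n : ℕ) {θ : ℝ} (hθ : |θ| * B ≤ 1) :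
    mgf (fun ω => ∑ d ∈ A, if d ∈ hits R n ω then s d else 0) P θ ≤
      Real.exp ((θ + θ ^ 2 * B) * ∑ d ∈ A, s d * (1 - (1 - p d) ^ n)) := by
  have hp : ∀ d, 0 ≤ 1 - p d ∧ 1 - p d ≤ 1 := fun d =>
    ⟨by rw [← hlaw 0 d]; linarith [measureReal_le_one (μ := P) (s := {ω | R 0 ω = d})],
      by rw [← hlaw 0 d]; linarith [measureReal_nonneg (μ := P) (s := {ω | R 0 ω = d})]⟩
  have hexp : ∀ ω, Real.exp (θ * ∑ d ∈ A, if d ∈ hits R n ω then s d else 0) =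
      (∏ d ∈ A, Real.exp (θ * s d)) * ∏ d ∈ A, (1 - (1 - Real.exp (-(θ * s d))) *
        if d ∈ hits R n ω then 0 else 1) := by
    intro ω
    rw [Finset.mul_sum, Real.exp_sum, ← Finset.prod_mul_distrib]
    refine Finset.prod_congr rfl fun d _ => ?_
    split_ifs
    · simp
    · rw [mul_one, sub_sub_cancel, ← Real.exp_add]; simp
  simp only [mgf, hexp]
  rw [integral_const_mul]
  refine (mul_le_mul_of_nonneg_left (integral_prod_hits_le hR hind hlaw A n
    (exp_neg_one_sub_oneSided hs θ)) (Finset.prod_nonneg fun d _ => (Real.exp_pos _).le)).trans ?_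
  rw [← Finset.prod_mul_distrib, Finset.mul_sum, Real.exp_sum]
  refine Finset.prod_le_prod (fun d _ => mul_nonneg (Real.exp_pos _).le ?_) fun d _ => ?_
  · have := ((exp_neg_one_sub_oneSided hs θ).mul (w := fun d => (1 - p d) ^ n) fun d =>
      ⟨pow_nonneg (hp d).1 n, pow_le_one₀ (hp d).1 (hp d).2⟩).le_one d
    linarith
  · have h1 : 0 ≤ 1 - (1 - p d) ^ n := sub_nonneg.mpr (pow_le_one₀ (hp d).1 (hp d).2)
    set h := 1 - (1 - p d) ^ n with hh
    have h2 : (1 - p d) ^ n = 1 - h := by rw [hh]; ring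
    have habs : |θ * s d| ≤ 1 := by
      rw [abs_mul, abs_of_nonneg (hs d)]
      exact (mul_le_mul_of_nonneg_left (hsB d) (abs_nonneg θ)).trans hθ
    -- The bound e^x - 1 - x ≤ x² needs |x| ≤ 1, whence the restriction on θ. By `h5` below, each
    -- factor is the exponential moment of an independent item hit with probability h.
    have h3 := (abs_le.mp (Real.abs_exp_sub_one_sub_id_le habs)).2
    have h4 : (θ * s d) ^ 2 ≤ θ ^ 2 * B * s d := by
      nlinarith [mul_nonneg (mul_nonneg (sq_nonneg θ) (hs d)) (sub_nonneg.mpr (hsB d))]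
    have h5 : Real.exp (θ * s d) * (1 - (1 - Real.exp (-(θ * s d))) * (1 - p d) ^ n) =
        (Real.exp (θ * s d) - 1) * h + 1 := by
      have : Real.exp (θ * s d) * Real.exp (-(θ * s d)) = 1 := by rw [← Real.exp_add]; simp
      rw [h2]
      linear_combination (1 - h) * this
    rw [h5]
    refine le_trans ?_ (Real.add_one_le_exp _)
    nlinarith

theorem integrable_exp_size_hits (hR : ∀ j, Measurable (R j)) (hs : ∀ d, 0 ≤ s d) (A : Finset ℕ)
    (n : ℕ) (θ : ℝ) :
    Integrable (fun ω => Real.exp (θ * ∑ d ∈ A, if d ∈ hits R n ω then s d else 0)) P := by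
  refine Integrable.of_bound (measurable_comp_hits hR n fun H =>
    Real.exp (θ * ∑ d ∈ A, if d ∈ H then s d else 0)).aestronglyMeasurable
    (Real.exp (|θ| * ∑ d ∈ A, s d)) (ae_of_all _ fun ω => ?_)
  rw [Real.norm_of_nonneg (Real.exp_pos _).le]
  gcongr
  · exact sum_ite_hits_nonneg hs A n ω
  · exact le_abs_self θ
  · split_ifs <;> simp [hs]

/-- Upper tail of the total size of the items hit by `n` independent requests. -/
theorem prob_lt_size_hits_le (hR : ∀ j, Measurable (R j)) (hind : iIndepFun R P)
    (hlaw : ∀ j d, P.real {ω | R j ω = d} = p d) (hs : ∀ d, 0 ≤ s d) (hsB : ∀ d, s d ≤ B)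
    (hB : 0 ≤ B) {n : ℕ} {m : ℝ} (hm : ∀ A : Finset ℕ, ∑ d ∈ A, s d * (1 - (1 - p d) ^ n) ≤ m)
    {θ : ℝ} (hθ0 : 0 ≤ θ) (hθ : θ * B ≤ 1) (y : ℝ) :
    P.real {ω | y < ∑ d ∈ hits R n ω, s d} ≤ Real.exp (-θ * y + (θ + θ ^ 2 * B) * m) := by
  set E : ℕ → Set Ω := fun L => {ω | y < ∑ d ∈ Finset.range L, if d ∈ hits R n ω then s d else 0}
  have hmono : Monotone E := by
    intro L L' hL ω hω
    refine lt_of_lt_of_le (show y < _ from hω) (Finset.sum_le_sum_of_subset_of_nonneg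
      (Finset.range_mono hL) fun d _ _ => by split_ifs <;> simp [hs])
  -- The moment bound concerns item sets fixed in advance. The random finite set of hits lies in
  -- some initial range, and continuity from below passes the bound to the union.
  have hU : {ω | y < ∑ d ∈ hits R n ω, s d} ⊆ ⋃ L, E L := by
    intro ω hω
    obtain ⟨L, hL⟩ := (hits R n ω).exists_nat_subset_range
    refine Set.mem_iUnion.mpr ⟨L, ?_⟩
    change y < _
    rwa [Finset.sum_ite_mem, Finset.inter_eq_right.mpr hL]
  have hbound : ∀ L, P (E L) ≤ ENNReal.ofReal (Real.exp (-θ * y + (θ + θ ^ 2 * B) * m)) := by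
    intro L
    rw [← ofReal_measureReal]
    refine ENNReal.ofReal_le_ofReal ?_
    refine (measureReal_mono (fun ω (hω : y < _) => hω.le)).trans
      ((measure_ge_le_exp_mul_mgf y hθ0 (integrable_exp_size_hits hR hs _ n θ)).trans ?_)
    refine (mul_le_mul_of_nonneg_left (mgf_size_hits_le hR hind hlaw hs hsB _ n
      (by rwa [abs_of_nonneg hθ0])) (Real.exp_pos _).le).trans ?_
    rw [← Real.exp_add]
    have := hm (Finset.range L)
    gcongr
  have h1 := (measure_mono hU).trans (le_of_tendsto (tendsto_measure_iUnion_atTop hmono)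
    (Eventually.of_forall hbound))
  exact ENNReal.toReal_le_of_le_ofReal (Real.exp_pos _).le h1

/-- Lower tail of the total size of the items hit by `n` independent requests. -/
theorem prob_size_hits_le_le (hR : ∀ j, Measurable (R j)) (hind : iIndepFun R P)
    (hlaw : ∀ j d, P.real {ω | R j ω = d} = p d) (hs : ∀ d, 0 ≤ s d) (hsB : ∀ d, s d ≤ B)
    {n : ℕ} {m : ℝ} (hm : HasSum (fun d => s d * (1 - (1 - p d) ^ n)) m)
    {θ : ℝ} (hθ0 : 0 ≤ θ) (hθ : θ * B ≤ 1) (y : ℝ) :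
    P.real {ω | ∑ d ∈ hits R n ω, s d ≤ y} ≤ Real.exp (θ * y - (θ - θ ^ 2 * B) * m) := by
  have hlim : Tendsto (fun A : Finset ℕ => Real.exp (θ * y - (θ - θ ^ 2 * B) *
      ∑ d ∈ A, s d * (1 - (1 - p d) ^ n))) atTop
      (𝓝 (Real.exp (θ * y - (θ - θ ^ 2 * B) * m))) :=
    (Real.continuous_exp.tendsto _).comp ((hm.const_mul _).const_sub _)
  refine ge_of_tendsto hlim (Eventually.of_forall fun A => ?_)
  have hsub : {ω | ∑ d ∈ hits R n ω, s d ≤ y} ⊆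
      {ω | ∑ d ∈ A, (if d ∈ hits R n ω then s d else 0) ≤ y} := by
    intro ω hω
    refine le_trans ?_ (show _ ≤ y from hω)
    rw [Finset.sum_ite_mem]
    exact Finset.sum_le_sum_of_subset_of_nonneg Finset.inter_subset_right fun d _ _ => hs d
  refine (measureReal_mono hsub).trans ((measure_le_le_exp_mul_mgf y (neg_nonpos.mpr hθ0)
    (integrable_exp_size_hits hR hs _ n (-θ))).trans ?_)
  refine (mul_le_mul_of_nonneg_left (mgf_size_hits_le hR hind hlaw hs hsB _ n
    (by rwa [abs_neg, abs_of_nonneg hθ0])) (Real.exp_pos _).le).trans (le_of_eq ?_)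
  rw [← Real.exp_add]
  congr 1
  ring

end Concentration

/-! ### Search cost, hit sets and the request stream -/

/-- An item in front of the item of request 0 has an access more recent than every past access to
that item, hence one within the last n requests. -/
theorem searchCost_le_of_mem_hits {Ω : Type*} {R : ℤ → Ω → ℕ} (size : ℕ → ℝ) (hs : ∀ d, 0 ≤ size d) {n : ℕ} {ω : Ω}
    (hmem : R 0 ω ∈ hits R n ω) :
    searchCost size (fun n => R n ω) 0 ≤ ENNReal.ofReal (∑ d ∈ hits R n ω, size d) := by
  rw [searchCost, ENNReal.ofReal_sum_of_nonneg fun d _ => hs d, tsum_eq_sum (s := hits R n ω)]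
  · exact Finset.sum_le_sum fun d _ => by split_ifs <;> simp
  · intro d hd
    obtain ⟨i, ⟨hi1, hi2⟩, hi⟩ := mem_hits.mp hmem
    rw [if_neg]
    rintro ⟨j, hj, rfl, hne⟩
    rcases le_or_gt j i with hji | hij
    · exact hne i hji hi2 hi
    · exact hd (mem_hits.mpr ⟨j, ⟨hi1.trans hij.le, hj⟩, rfl⟩)

/-- If the item of request 0 is absent from the window, every item accessed in the window is in
front of it. -/
theorem le_searchCost_of_notMem_hits {Ω : Type*} {R : ℤ → Ω → ℕ} (size : ℕ → ℝ) (hs : ∀ d, 0 ≤ size d) {n : ℕ} {ω : Ω}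
    (hmem : R 0 ω ∉ hits R n ω) :
    ENNReal.ofReal (∑ d ∈ hits R n ω, size d) ≤ searchCost size (fun n => R n ω) 0 := by
  rw [searchCost, ENNReal.ofReal_sum_of_nonneg fun d _ => hs d]
  refine le_trans (Finset.sum_le_sum fun d hd => ?_) (ENNReal.sum_le_tsum (hits R n ω))
  obtain ⟨j, ⟨hj1, hj2⟩, rfl⟩ := mem_hits.mp hd
  rw [if_pos ⟨j, hj2, rfl, fun i hi1 hi2 he => hmem (mem_hits.mpr ⟨i, ⟨hj1.trans hi1, hi2⟩, he⟩)⟩]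

namespace CacheModel

variable {M : ℕ} (S : CacheModel M)

theorem nu_pos (k : Fin M) : 0 < S.nu k :=
  div_pos (S.rate_pos k) (Finset.sum_pos (fun j _ => S.rate_pos j) ⟨k, Finset.mem_univ k⟩)

theorem pMix_nonneg (d : ℕ) : 0 ≤ S.pMix d := by
  unfold pMix mixedProb
  exact Finset.sum_nonneg fun j _ => mul_nonneg (S.nu_pos j).le ENNReal.toReal_nonneg

theorem nu_mul_law_le_pMix (k : Fin M) (d : ℕ) : S.nu k * (S.law k d).toReal ≤ S.pMix d :=
  Finset.single_le_sum (f := fun j => S.nu j * (S.law j d).toReal)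
    (fun j _ => mul_nonneg (S.nu_pos j).le ENNReal.toReal_nonneg) (Finset.mem_univ k)

theorem hasSum_law (k : Fin M) : HasSum (fun d => (S.law k d).toReal) 1 := by
  have := ENNReal.hasSum_toReal (S.law k).tsum_coe_ne_top
  rwa [← ENNReal.tsum_toReal_eq (S.law k).apply_ne_top, (S.law k).tsum_coe,
    ENNReal.toReal_one] at this

theorem hasSum_pMix (k : Fin M) : HasSum S.pMix 1 := by
  have h1 : HasSum (fun d => ∑ j, S.nu j * (S.law j d).toReal) (∑ j, S.nu j * 1) :=
    hasSum_sum fun j _ => (S.hasSum_law j).mul_left _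
  have h2 : ∑ j, S.nu j * 1 = 1 := by
    have h3 : 0 < ∑ j, S.rate j := Finset.sum_pos (fun j _ => S.rate_pos j) ⟨k, Finset.mem_univ k⟩
    simp only [mul_one, nu, flowFraction]
    rw [← Finset.sum_div, div_self h3.ne']
  rwa [h2] at h1

theorem pMix_le_one (k : Fin M) (d : ℕ) : S.pMix d ≤ 1 :=
  le_hasSum (S.hasSum_pMix k) d fun d _ => S.pMix_nonneg d

theorem tsum_item (k : Fin M) (g : ℕ → ℝ) :
    ∑' i, S.q k i * g (S.item k i) = ∑' d, (S.law k d).toReal * g d := by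
  refine (S.item_injective k).tsum_eq (f := fun d => (S.law k d).toReal * g d) fun d hd => ?_
  refine S.law_support k ((PMF.mem_support_iff _ _).mpr fun h => ?_)
  simp [h] at hd

section Stream

variable {S} {Ω : Type*} [MeasurableSpace Ω] {P : Measure Ω}
  {I : ℤ → Ω → Fin M} {R : ℤ → Ω → ℕ}

theorem IsRequestStream.iIndepFun_item (h : S.IsRequestStream P I R) : iIndepFun R P :=
  h.indep.comp (fun _ => Prod.snd) fun _ => measurable_snd

theorem IsRequestStream.item_law [IsProbabilityMeasure P] (h : S.IsRequestStream P I R) (n : ℤ) (d : ℕ) :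
    P.real {ω | R n ω = d} = S.pMix d := by
  have h1 : {ω | R n ω = d} = ⋃ k ∈ Finset.univ, {ω | I n ω = k ∧ R n ω = d} := by
    ext ω; simp
  rw [h1, measureReal_biUnion_finset]
  · refine Finset.sum_congr rfl fun k _ => ?_
    rw [measureReal_def, h.joint_law, ENNReal.toReal_mul, ENNReal.toReal_ofReal (S.nu_pos k).le]
    rfl
  · intro i _ j _ hij
    exact Set.disjoint_left.mpr fun ω hi hj => hij (hi.1.symm.trans hj.1)
  · intro k _
    exact (h.measurable_flow n (MeasurableSet.singleton k)).inter
      (h.measurable_item n (MeasurableSet.singleton d))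

theorem IsRequestStream.indepFun_hits (h : S.IsRequestStream P I R) (n : ℕ) :
    IndepFun (fun ω => (I 0 ω, R 0 ω)) (fun ω (j : Finset.Ico (-(n : ℤ)) 0) => R j ω) P :=
  indepFun_tuple (Z := fun n ω => (I n ω, R n ω))
    (fun j => (h.measurable_flow j).prodMk (h.measurable_item j)) h.indep measurable_snd
    (by simp)

theorem IsRequestStream.prob_inter_hits [IsProbabilityMeasure P] (h : S.IsRequestStream P I R) (n : ℕ)
    (A : Set (Fin M × ℕ)) (B : Set (Finset ℕ)) :
    P ({ω | (I 0 ω, R 0 ω) ∈ A} ∩ {ω | hits R n ω ∈ B}) =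
      P {ω | (I 0 ω, R 0 ω) ∈ A} * P {ω | hits R n ω ∈ B} := by
  simp only [hits_eq_image_univ]
  exact (h.indepFun_hits n).measure_inter_preimage_eq_mul A
    {y | Finset.univ.image y ∈ B} MeasurableSet.of_discrete MeasurableSet.of_discrete

theorem IsRequestStream.flow_law (h : S.IsRequestStream P I R) (k : Fin M) :
    P {ω | I 0 ω = k} = ENNReal.ofReal (S.nu k) := by
  have h1 : {ω | I 0 ω = k} = ⋃ d, {ω | I 0 ω = k ∧ R 0 ω = d} := by ext ω; simp
  rw [h1, measure_iUnion]
  · simp only [h.joint_law]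
    rw [ENNReal.tsum_mul_left, (S.law k).tsum_coe, mul_one]
  · intro i j hij
    exact Set.disjoint_left.mpr fun ω hi hj => hij (hi.2.symm.trans hj.2)
  · intro d
    exact (h.measurable_flow 0 (MeasurableSet.singleton k)).inter
      (h.measurable_item 0 (MeasurableSet.singleton d))

/-- The probability that the item of a request of flow `k` is not among the last `n` requests. -/
theorem IsRequestStream.cond_notMem_hits [IsProbabilityMeasure P] (h : S.IsRequestStream P I R) (k : Fin M) (n : ℕ) :
    (P[|{ω | I 0 ω = k}]).real {ω | R 0 ω ∉ hits R n ω} = ∑' i, S.q k i * (1 - S.p k i) ^ n := by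
  have hmk : MeasurableSet {ω | I 0 ω = k} := h.measurable_flow 0 (MeasurableSet.singleton k)
  have hpos := S.nu_pos k
  -- Splitting by the item d of request 0 makes each piece a product event: request 0 is independent
  -- of the window.
  have h1 : {ω | I 0 ω = k} ∩ {ω | R 0 ω ∉ hits R n ω} =
      ⋃ d, {ω | (I 0 ω, R 0 ω) ∈ ({(k, d)} : Set (Fin M × ℕ))} ∩
        {ω | hits R n ω ∈ {H : Finset ℕ | d ∉ H}} := by
    ext ω
    simp
  have h2 : ∀ d, P {ω | (I 0 ω, R 0 ω) ∈ ({(k, d)} : Set (Fin M × ℕ))} =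
      ENNReal.ofReal (S.nu k) * S.law k d := fun d => by
    rw [← h.joint_law 0 k d]; congr 1; ext ω; simp
  have h3 : ∀ d, P {ω | hits R n ω ∈ {H : Finset ℕ | d ∉ H}} =
      ENNReal.ofReal ((1 - S.pMix d) ^ n) := fun d => by
    rw [← prob_notMem_hits h.measurable_item h.iIndepFun_item (fun j => h.item_law j d) n,
      ofReal_measureReal]
    rfl
  have hm : ∀ d, MeasurableSet ({ω | (I 0 ω, R 0 ω) ∈ ({(k, d)} : Set (Fin M × ℕ))} ∩
        {ω | hits R n ω ∈ {H : Finset ℕ | d ∉ H}}) := fun d =>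
    (((h.measurable_flow 0).prodMk (h.measurable_item 0)) (MeasurableSet.singleton _)).inter
      (measurableSet_hits h.measurable_item n _)
  rw [measureReal_def, cond_apply hmk, h.flow_law, h1, measure_iUnion _ hm]
  · simp only [h.prob_inter_hits, h2, h3, mul_assoc]
    rw [ENNReal.tsum_mul_left, ← mul_assoc, ENNReal.inv_mul_cancel (by simpa using hpos)
      ENNReal.ofReal_ne_top, one_mul, ENNReal.tsum_toReal_eq]
    · rw [show (∑' i, S.q k i * (1 - S.p k i) ^ n) = _ from
        S.tsum_item k fun d => (1 - S.pMix d) ^ n]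
      refine tsum_congr fun d => ?_
      rw [ENNReal.toReal_mul, ENNReal.toReal_ofReal
        (pow_nonneg (sub_nonneg.mpr (S.pMix_le_one k d)) n)]
    · exact fun d => ENNReal.mul_ne_top ((S.law k).apply_ne_top d) ENNReal.ofReal_ne_top
  · intro i j hij
    refine Set.disjoint_left.mpr fun ω hi hj => hij ?_
    have a := hi.1
    have b := hj.1
    simp at a b
    exact a.2.symm.trans b.2

theorem IsRequestStream.cond_hits [IsProbabilityMeasure P] (h : S.IsRequestStream P I R) (k : Fin M) (n : ℕ)
    (B : Set (Finset ℕ)) :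
    (P[|{ω | I 0 ω = k}]).real {ω | hits R n ω ∈ B} = P.real {ω | hits R n ω ∈ B} := by
  have hmk : MeasurableSet {ω | I 0 ω = k} := h.measurable_flow 0 (MeasurableSet.singleton k)
  have h1 := h.prob_inter_hits n {z | z.1 = k} B
  simp only [Set.mem_ofPred_eq] at h1
  have hpos := S.nu_pos k
  rw [measureReal_def, measureReal_def, cond_apply hmk]
  erw [h1]
  rw [h.flow_law, ← mul_assoc, ENNReal.inv_mul_cancel (by simpa using hpos)
      ENNReal.ofReal_ne_top, one_mul]

theorem IsRequestStream.isProbabilityMeasure_cond [IsProbabilityMeasure P]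
    (h : S.IsRequestStream P I R) (k : Fin M) :
    IsProbabilityMeasure (P[|{ω | I 0 ω = k}]) :=
  cond_isProbabilityMeasure (by rw [h.flow_law]; simpa using S.nu_pos k)

/-- A miss requires the item to be absent from the window or the window to be unusually large. The
second event does not depend on request 0, so the conditioning drops out of it. -/
theorem IsRequestStream.missProb_le [IsProbabilityMeasure P] (h : S.IsRequestStream P I R)
    (k : Fin M) (n : ℕ) (x : ℝ) :
    missProb S.size P I R k x ≤
      ∑' i, S.q k i * (1 - S.p k i) ^ n + P.real {ω | x < ∑ d ∈ hits R n ω, S.size d} := by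
  have := h.isProbabilityMeasure_cond k
  rw [← h.cond_notMem_hits k n]
  have hsub : {ω | ENNReal.ofReal x < searchCost S.size (fun n => R n ω) 0} ⊆
      {ω | R 0 ω ∉ hits R n ω} ∪ {ω | x < ∑ d ∈ hits R n ω, S.size d} := by
    intro ω hω
    by_cases hmem : R 0 ω ∈ hits R n ω
    · have h1 := (show _ < _ from hω).trans_le
        (searchCost_le_of_mem_hits S.size S.size_nonneg hmem)
      exact Or.inr (lt_of_not_ge fun hle => (ENNReal.ofReal_le_ofReal hle).not_gt h1)
    · exact Or.inl hmem
  have h2 := h.cond_hits k n {H | x < ∑ d ∈ H, S.size d}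
  simp only [Set.mem_ofPred_eq] at h2
  rw [← h2]
  exact (measureReal_mono hsub).trans (measureReal_union_le _ _)

theorem IsRequestStream.le_missProb [IsProbabilityMeasure P] (h : S.IsRequestStream P I R)
    (k : Fin M) (n : ℕ) {x : ℝ} (hx : 0 ≤ x) :
    ∑' i, S.q k i * (1 - S.p k i) ^ n ≤
      missProb S.size P I R k x + P.real {ω | ∑ d ∈ hits R n ω, S.size d ≤ x} := by
  have := h.isProbabilityMeasure_cond k
  rw [← h.cond_notMem_hits k n]
  have hsub : {ω | R 0 ω ∉ hits R n ω} ⊆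
      {ω | ENNReal.ofReal x < searchCost S.size (fun n => R n ω) 0} ∪
        {ω | ∑ d ∈ hits R n ω, S.size d ≤ x} := by
    intro ω hω
    rcases le_or_gt (∑ d ∈ hits R n ω, S.size d) x with hle | hlt
    · exact Or.inr hle
    · exact Or.inl (((ENNReal.ofReal_lt_ofReal_iff (hx.trans_lt hlt)).mpr hlt).trans_le
        (le_searchCost_of_notMem_hits S.size S.size_nonneg hω))
  have h2 := h.cond_hits k n {H | ∑ d ∈ H, S.size d ≤ x}
  simp only [Set.mem_ofPred_eq] at h2
  rw [← h2]
  exact (measureReal_mono hsub).trans (measureReal_union_le _ _)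

end Stream

end CacheModel

/-! ### Comparison of powers with exponentials -/

section Elementary

variable {p z : ℝ}

theorem one_sub_rpow_le_exp (hp1 : p ≤ 1) (hz : 0 ≤ z) : (1 - p) ^ z ≤ Real.exp (-(p * z)) := by
  rw [← neg_mul, Real.exp_mul]
  refine Real.rpow_le_rpow (by linarith) ?_ hz
  linarith [Real.add_one_le_exp (-p)]

/-- From e^{-p}(1 + p) ≤ 1 follows e^{-p}(1 - p²) ≤ 1 - p; raise this to the power z and use
Bernoulli. -/
theorem exp_mul_le_one_sub_rpow (hp0 : 0 ≤ p) (hp1 : p ≤ 1) (hz : 1 ≤ z) :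
    Real.exp (-(p * z)) * (1 - z * p ^ 2) ≤ (1 - p) ^ z := by
  have h1 : 1 - z * p ^ 2 ≤ (1 - p ^ 2) ^ z := by
    have := one_add_mul_self_le_rpow_one_add (s := -p ^ 2) (by nlinarith) hz
    rw [← sub_eq_add_neg] at this
    linarith
  have h2 : Real.exp (-p) * (1 - p ^ 2) ≤ 1 - p := by
    have h3 := Real.add_one_le_exp p
    have h4 : Real.exp (-p) * Real.exp p = 1 := by rw [← Real.exp_add]; simp
    have h5 := mul_le_mul_of_nonneg_left h3 (Real.exp_pos (-p)).le
    nlinarith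
  have h6 : 0 ≤ 1 - p ^ 2 := by nlinarith
  calc Real.exp (-(p * z)) * (1 - z * p ^ 2) ≤ Real.exp (-(p * z)) * (1 - p ^ 2) ^ z := by gcongr
    _ = (Real.exp (-p) * (1 - p ^ 2)) ^ z := by
      rw [Real.mul_rpow (Real.exp_pos _).le h6, ← Real.exp_mul, neg_mul]
    _ ≤ _ := Real.rpow_le_rpow (mul_nonneg (Real.exp_pos _).le h6) h2 (by linarith)

/-- The error e^{-pz} z p² is at most p because y e^{-y} ≤ 1. The bound is uniform in z and summable
over the items. -/
theorem exp_sub_one_sub_rpow_le (hp0 : 0 ≤ p) (hp1 : p ≤ 1) (hz : 1 ≤ z) :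
    Real.exp (-(p * z)) - (1 - p) ^ z ≤ p := by
  have h1 := exp_mul_le_one_sub_rpow hp0 hp1 hz
  have h2 : p * z ≤ Real.exp (p * z) := by linarith [Real.add_one_le_exp (p * z)]
  have h3 : Real.exp (-(p * z)) * (p * z) ≤ 1 := by
    rw [Real.exp_neg]
    exact (inv_mul_le_one₀ (Real.exp_pos _)).mpr h2
  nlinarith

/-- The factor (pn)² in the error is absorbed by half of the exponential, leaving a factor 1/n. The
8 comes from x²/2 ≤ e^x at x = pn/2. -/
theorem exp_sub_one_sub_pow_le (hp0 : 0 ≤ p) (hp1 : p ≤ 1) {n : ℕ} (hn : 1 ≤ n) :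
    Real.exp (-(p * n)) - (1 - p) ^ n ≤ 8 / n * Real.exp (-(p * (n / 2))) := by
  have hn1 : (1 : ℝ) ≤ n := by exact_mod_cast hn
  have h1 := exp_mul_le_one_sub_rpow hp0 hp1 hn1
  rw [Real.rpow_natCast] at h1
  have h2 := Real.quadratic_le_exp_of_nonneg (x := p * (n / 2)) (by positivity)
  have h3 : (p * n) ^ 2 ≤ 8 * Real.exp (p * (n / 2)) := by
    have : 0 ≤ p * (n / 2) := by positivity
    nlinarith
  have h4 : Real.exp (-(p * n)) * Real.exp (p * (n / 2)) = Real.exp (-(p * (n / 2))) := by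
    rw [← Real.exp_add]; congr 1; ring
  have h5 := mul_le_mul_of_nonneg_left h3 (Real.exp_pos (-(p * n))).le
  have h6 : Real.exp (-(p * n)) * (n * p ^ 2) ≤ 8 / n * Real.exp (-(p * (n / 2))) := by
    rw [div_mul_eq_mul_div, le_div_iff₀ (by linarith), ← h4]
    nlinarith
  linarith

theorem one_sub_one_sub_rpow_nonneg (hp0 : 0 ≤ p) (hp1 : p ≤ 1) (hz : 0 ≤ z) :
    0 ≤ 1 - (1 - p) ^ z :=
  sub_nonneg.mpr (Real.rpow_le_one (by linarith) (by linarith) hz)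

theorem one_sub_rpow_antitone (hp0 : 0 ≤ p) (hp1 : p ≤ 1) {w : ℝ} (hz : 0 ≤ z) (hzw : z ≤ w) :
    (1 - p) ^ w ≤ (1 - p) ^ z :=
  Real.rpow_le_rpow_of_exponent_ge' (by linarith) (by linarith) hz hzw

theorem one_sub_one_sub_rpow_le (hp0 : 0 ≤ p) (hp1 : p ≤ 1) (hz : 0 ≤ z) :
    1 - (1 - p) ^ z ≤ (z + 1) * p := by
  -- Bernoulli needs an exponent at least 1, so z is raised to z + 1.
  have h1 := one_sub_rpow_antitone hp0 hp1 hz (by linarith : z ≤ z + 1)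
  have h2 := one_add_mul_self_le_rpow_one_add (s := -p) (by linarith) (by linarith : 1 ≤ z + 1)
  rw [← sub_eq_add_neg] at h2
  linarith

end Elementary

/-! ### The functions m, its inverse, and the characteristic time -/

namespace CacheModel

variable {M : ℕ} (S : CacheModel M)

theorem exists_size_le : ∃ B : ℝ, 1 ≤ B ∧ ∀ d, S.size d ≤ B := by
  obtain ⟨B, hB⟩ := S.size_bdd
  exact ⟨max 1 B, le_max_left _ _, fun d => (hB ⟨d, rfl⟩).trans (le_max_right _ _)⟩

theorem summable_size_mul_pMix (k : Fin M) : Summable fun d => S.size d * S.pMix d := by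
  obtain ⟨B, -, hB⟩ := S.exists_size_le
  exact ((S.hasSum_pMix k).summable.mul_left B).of_nonneg_of_le
    (fun d => mul_nonneg (S.size_nonneg d) (S.pMix_nonneg d))
    fun d => mul_le_mul_of_nonneg_right (hB d) (S.pMix_nonneg d)

theorem tsum_size_mul_pMix_le (k : Fin M) {B : ℝ} (hB : ∀ d, S.size d ≤ B) :
    ∑' d, S.size d * S.pMix d ≤ B := by
  have h1 := (S.hasSum_pMix k).mul_left B
  rw [mul_one] at h1
  rw [← h1.tsum_eq]
  exact (S.summable_size_mul_pMix k).tsum_le_tsum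
    (fun d => mul_le_mul_of_nonneg_right (hB d) (S.pMix_nonneg d)) h1.summable

theorem summable_m (k : Fin M) {z : ℝ} (hz : 0 ≤ z) :
    Summable fun d => S.size d * (1 - (1 - S.pMix d) ^ z) :=
  ((S.summable_size_mul_pMix k).mul_left (z + 1)).of_nonneg_of_le
    (fun d => mul_nonneg (S.size_nonneg d)
      (one_sub_one_sub_rpow_nonneg (S.pMix_nonneg d) (S.pMix_le_one k d) hz)) fun d => by
    rw [mul_left_comm]
    exact mul_le_mul_of_nonneg_left
      (one_sub_one_sub_rpow_le (S.pMix_nonneg d) (S.pMix_le_one k d) hz) (S.size_nonneg d)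

theorem hasSum_m_nat (k : Fin M) (n : ℕ) :
    HasSum (fun d => S.size d * (1 - (1 - S.pMix d) ^ n)) (S.m n) := by
  have := (S.summable_m k (Nat.cast_nonneg n)).hasSum
  simp only [Real.rpow_natCast] at this
  convert this using 1
  simp [m]

theorem m_monotoneOn (k : Fin M) : MonotoneOn S.m (Set.Ici 0) := by
  intro z hz w hw hzw
  refine (S.summable_m k hz).tsum_le_tsum (fun d => ?_) (S.summable_m k hw)
  exact mul_le_mul_of_nonneg_left (sub_le_sub_left
    (one_sub_rpow_antitone (S.pMix_nonneg d) (S.pMix_le_one k d) hz hzw) 1) (S.size_nonneg d)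

theorem exists_size_pos (hm : Tendsto S.m atTop atTop) : ∃ d, 0 < S.size d ∧ 0 < S.pMix d := by
  by_contra! hcon
  obtain ⟨z, hz⟩ := (hm.eventually (eventually_gt_atTop 0)).exists
  refine hz.ne' ((tsum_congr fun d => ?_).trans tsum_zero)
  rcases (S.size_nonneg d).eq_or_lt with h | h
  · rw [← h, zero_mul]
  · rw [le_antisymm (hcon d h) (S.pMix_nonneg d)]; simp

theorem m_strictMonoOn (k : Fin M) (hlt : ∀ d, S.pMix d < 1)
    (hex : ∃ d, 0 < S.size d ∧ 0 < S.pMix d) : StrictMonoOn S.m (Set.Ici 0) := by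
  intro z hz w hw hzw
  obtain ⟨e, hse, hpe⟩ := hex
  refine Summable.tsum_lt_tsum (i := e) (fun d => ?_) ?_ (S.summable_m k hz) (S.summable_m k hw)
  · exact mul_le_mul_of_nonneg_left (sub_le_sub_left
      (one_sub_rpow_antitone (S.pMix_nonneg d) (S.pMix_le_one k d) hz hzw.le) 1) (S.size_nonneg d)
  · exact mul_lt_mul_of_pos_left (sub_lt_sub_left (Real.rpow_lt_rpow_of_exponent_gt
      (by linarith [hlt e]) (by linarith) hzw) 1) hse

theorem cheSize_term_nonneg {T : ℝ} (hT : 0 ≤ T) (d : ℕ) :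
    0 ≤ 1 - Real.exp (-(S.pMix d * T)) :=
  sub_nonneg.mpr (Real.exp_le_one_iff.mpr (neg_nonpos.mpr (mul_nonneg (S.pMix_nonneg d) hT)))

theorem cheSize_term_le {T b : ℝ} (hTb : T ≤ b) (d : ℕ) :
    S.size d * (1 - Real.exp (-(S.pMix d * T))) ≤ b * (S.size d * S.pMix d) := by
  rw [mul_left_comm]
  refine mul_le_mul_of_nonneg_left ?_ (S.size_nonneg d)
  have := Real.add_one_le_exp (-(S.pMix d * T))
  nlinarith [mul_le_mul_of_nonneg_left hTb (S.pMix_nonneg d)]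

theorem summable_cheSize (k : Fin M) {T : ℝ} (hT : 0 ≤ T) :
    Summable fun d => S.size d * (1 - Real.exp (-(S.pMix d * T))) :=
  ((S.summable_size_mul_pMix k).mul_left T).of_nonneg_of_le
    (fun d => mul_nonneg (S.size_nonneg d) (S.cheSize_term_nonneg hT d))
    (S.cheSize_term_le le_rfl)

theorem cheSize_strictMonoOn (k : Fin M) (hex : ∃ d, 0 < S.size d ∧ 0 < S.pMix d) :
    StrictMonoOn S.cheSize (Set.Ici 0) := by
  intro z hz w hw hzw
  obtain ⟨e, hse, hpe⟩ := hex
  refine Summable.tsum_lt_tsum (i := e) (fun d => ?_) ?_ (S.summable_cheSize k hz)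
    (S.summable_cheSize k hw)
  · have := S.size_nonneg d
    have := S.pMix_nonneg d
    gcongr
  · gcongr

theorem cheSize_continuousOn (k : Fin M) (b : ℝ) : ContinuousOn S.cheSize (Set.Icc 0 b) := by
  refine continuousOn_tsum (fun d => by fun_prop) ((S.summable_size_mul_pMix k).mul_left b) ?_
  intro d T hT
  rw [Real.norm_of_nonneg (mul_nonneg (S.size_nonneg d) (S.cheSize_term_nonneg hT.1 d))]
  exact S.cheSize_term_le hT.2 d

theorem cheSize_le_m (k : Fin M) {z : ℝ} (hz : 0 ≤ z) : S.cheSize z ≤ S.m z :=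
  (S.summable_cheSize k hz).tsum_le_tsum (fun d => mul_le_mul_of_nonneg_left
    (sub_le_sub_left (one_sub_rpow_le_exp (S.pMix_le_one k d) hz) 1) (S.size_nonneg d))
    (S.summable_m k hz)

theorem m_le_cheSize_add (k : Fin M) {B : ℝ} (hB : ∀ d, S.size d ≤ B) {z : ℝ} (hz : 1 ≤ z) :
    S.m z ≤ S.cheSize z + B := by
  have hz0 : 0 ≤ z := by linarith
  refine le_trans ?_ (add_le_add_right (S.tsum_size_mul_pMix_le k hB) _)
  rw [cheSize, ← (S.summable_cheSize k hz0).tsum_add (S.summable_size_mul_pMix k)]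
  refine (S.summable_m k hz0).tsum_le_tsum (fun d => ?_)
    ((S.summable_cheSize k hz0).add (S.summable_size_mul_pMix k))
  rw [← mul_add]
  refine mul_le_mul_of_nonneg_left ?_ (S.size_nonneg d)
  linarith [exp_sub_one_sub_rpow_le (S.pMix_nonneg d) (S.pMix_le_one k d) hz]

/-- The characteristic time is well defined. -/
theorem existsUnique_cheSize_eq (k : Fin M) (hm : Tendsto S.m atTop atTop) {x : ℝ} (hx : 0 ≤ x) :
    ∃! T : ℝ, 0 ≤ T ∧ S.cheSize T = x := by
  obtain ⟨B, -, hB⟩ := S.exists_size_le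
  obtain ⟨b, hb, hb1⟩ := ((hm.eventually (eventually_ge_atTop (x + B))).and
    (eventually_ge_atTop 1)).exists
  have hxb : x ≤ S.cheSize b := by linarith [S.m_le_cheSize_add k hB hb1]
  have h0 : S.cheSize 0 = 0 := by simp [cheSize]
  obtain ⟨T, hT, hTx⟩ := intermediate_value_Icc (by linarith : (0 : ℝ) ≤ b)
    (S.cheSize_continuousOn k b) ⟨h0.le.trans hx, hxb⟩
  exact ⟨T, ⟨hT.1, hTx⟩, fun T' hT' => (S.cheSize_strictMonoOn k (S.exists_size_pos hm)).injOn
    hT'.1 hT.1 (hT'.2.trans hTx.symm)⟩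

theorem bddBelow_mInv_set (x : ℝ) : BddBelow {z | 0 ≤ z ∧ x ≤ S.m z} := ⟨0, fun _ hz => hz.1⟩

theorem nonempty_mInv_set (hm : Tendsto S.m atTop atTop) (x : ℝ) :
    {z | 0 ≤ z ∧ x ≤ S.m z}.Nonempty :=
  ((eventually_ge_atTop 0).and (hm.eventually (eventually_ge_atTop x))).exists

theorem mInv_le {x z : ℝ} (hz : 0 ≤ z) (h : x ≤ S.m z) : S.mInv x ≤ z :=
  csInf_le (S.bddBelow_mInv_set x) ⟨hz, h⟩

/-- Follows from the infimum and monotonicity alone, without continuity of m. -/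
theorem le_m_of_mInv_lt (k : Fin M) (hm : Tendsto S.m atTop atTop) {x z : ℝ} (h : S.mInv x < z) :
    x ≤ S.m z := by
  obtain ⟨w, ⟨hw0, hw⟩, hwz⟩ := exists_lt_of_csInf_lt (S.nonempty_mInv_set hm x) h
  exact hw.trans (S.m_monotoneOn k hw0 (hw0.trans hwz.le) hwz.le)

theorem mInv_monotone (hm : Tendsto S.m atTop atTop) : Monotone S.mInv := fun x y hxy =>
  csInf_le_csInf (S.bddBelow_mInv_set x) (S.nonempty_mInv_set hm y)
    fun _ hz => ⟨hz.1, hxy.trans hz.2⟩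

theorem mInv_m (k : Fin M) (hm : Tendsto S.m atTop atTop) (hlt : ∀ d, S.pMix d < 1) {z : ℝ}
    (hz : 0 ≤ z) : S.mInv (S.m z) = z :=
  le_antisymm (S.mInv_le hz le_rfl) (le_csInf (S.nonempty_mInv_set hm _) fun _ hw =>
    (S.m_strictMonoOn k hlt (S.exists_size_pos hm)).le_iff_le hz hw.1 |>.mp hw.2)

theorem tendsto_mInv (k : Fin M) (hm : Tendsto S.m atTop atTop) :
    Tendsto S.mInv atTop atTop := by
  refine tendsto_atTop.mpr fun K => ?_
  filter_upwards [eventually_gt_atTop (S.m (max K 0))] with x hx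
  refine (le_max_left K 0).trans (le_of_not_gt fun h => ?_)
  exact hx.not_ge (S.le_m_of_mInv_lt k hm h)

end CacheModel

/-! ### Equivalence by sandwiching, and small changes of scale -/

section Asymptotics

theorem isEquivalent_of_eventually_le {u v : ℝ → ℝ} (hv : ∀ᶠ x in atTop, 0 < v x)
    (hup : ∀ b > 1, ∀ᶠ x in atTop, u x ≤ b * v x) (hlow : ∀ a < 1, ∀ᶠ x in atTop, a * v x ≤ u x) :
    u ~[atTop] v := by
  rw [isEquivalent_iff_tendsto_one (hv.mono fun x hx => hx.ne'), tendsto_order]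
  constructor
  · intro a ha
    obtain ⟨a', h1, h2⟩ := exists_between ha
    filter_upwards [hv, hlow a' h2] with x hx hxa
    exact h1.trans_le ((le_div_iff₀ hx).mpr hxa)
  · intro b hb
    obtain ⟨b', h1, h2⟩ := exists_between hb
    filter_upwards [hv, hup b' h1] with x hx hxb
    exact ((div_le_iff₀ hx).mpr hxb).trans_lt h2

variable {H : ℝ → ℝ} {β : ℝ}

theorem tendsto_rpow_neg_one (β : ℝ) : Tendsto (fun c : ℝ => c ^ (-β)) (𝓝 1) (𝓝 1) := by
  have := (Real.continuousAt_rpow_const 1 (-β) (Or.inl one_ne_zero)).tendsto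
  rwa [Real.one_rpow] at this

theorem exists_lt_one_eventually_le_mul (hpos : ∀ᶠ t in atTop, 0 < H t)
    (hreg : ∀ c > 0, Tendsto (fun t => H (c * t) / H t) atTop (𝓝 (c ^ (-β)))) {b : ℝ}
    (hb : 1 < b) : ∃ c : ℝ, 0 < c ∧ c < 1 ∧ ∀ᶠ t in atTop, H (c * t) ≤ b * H t := by
  obtain ⟨c, ⟨hcb, hc0⟩, hc1⟩ := (((((tendsto_rpow_neg_one β).eventually
    (gt_mem_nhds hb)).and (lt_mem_nhds (zero_lt_one' ℝ))).filter_mono nhdsWithin_le_nhds).and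
      (self_mem_nhdsWithin (s := Set.Iio (1 : ℝ)))).exists
  refine ⟨c, hc0, hc1, ?_⟩
  filter_upwards [hpos, (hreg c hc0).eventually (gt_mem_nhds hcb)] with t ht h
  exact ((div_lt_iff₀ ht).mp h).le

theorem exists_one_lt_eventually_mul_le (hpos : ∀ᶠ t in atTop, 0 < H t)
    (hreg : ∀ c > 0, Tendsto (fun t => H (c * t) / H t) atTop (𝓝 (c ^ (-β)))) {a : ℝ}
    (ha : a < 1) : ∃ c : ℝ, 1 < c ∧ ∀ᶠ t in atTop, a * H t ≤ H (c * t) := by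
  obtain ⟨c, hca, hc1⟩ := ((((tendsto_rpow_neg_one β).eventually
    (lt_mem_nhds ha)).filter_mono nhdsWithin_le_nhds).and
      (self_mem_nhdsWithin (s := Set.Ioi (1 : ℝ)))).exists
  refine ⟨c, hc1, ?_⟩
  filter_upwards [hpos, (hreg c (zero_lt_one.trans hc1)).eventually (lt_mem_nhds hca)] with t ht h
  exact ((lt_div_iff₀ ht).mp h).le

end Asymptotics

/-! ### Size deviations on the scale δ, and power versus exponential sums -/

namespace CacheModel

variable {M : ℕ} {S : CacheModel M}

theorem eventually_exp_le_mInv_pow (k : Fin M) (hm : Tendsto S.m atTop atTop) {δ : ℝ → ℝ}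
    (hδ : ∀ᶠ x in atTop, 0 < δ x ∧ δ x ≤ 1)
    (hlog : Tendsto (fun x => Real.log (S.mInv x) / (δ x ^ 2 * x)) atTop (𝓝 0))
    {κ : ℝ} (hκ : 0 < κ) (a : ℕ) :
    ∀ᶠ x in atTop, Real.exp (-(κ * (δ x ^ 2 * x))) ≤ (S.mInv x ^ a)⁻¹ := by
  have hpos : 0 < κ / (a + 1) := by positivity
  filter_upwards [hδ, hlog.eventually (gt_mem_nhds hpos), eventually_gt_atTop 0,
    (S.tendsto_mInv k hm).eventually (eventually_ge_atTop 1)] with x hδx hx hx0 hτ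
  have h1 : 0 < δ x ^ 2 * x := mul_pos (pow_pos hδx.1 2) hx0
  rw [div_lt_div_iff₀ h1 (by positivity)] at hx
  have h2 := Real.log_nonneg hτ
  have h3 : S.mInv x ^ a = Real.exp (a * Real.log (S.mInv x)) := by
    rw [mul_comm, Real.exp_mul, Real.exp_log (by linarith), Real.rpow_natCast]
  rw [h3, ← Real.exp_neg]
  refine Real.exp_le_exp.mpr (neg_le_neg ?_)
  nlinarith

/-- Since δ ≤ 1, δ x dominates δ² x, which eventually exceeds log m^←(x). -/
theorem tendsto_mul_self_atTop (k : Fin M) (hm : Tendsto S.m atTop atTop) {δ : ℝ → ℝ}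
    (hδ : ∀ᶠ x in atTop, 0 < δ x ∧ δ x ≤ 1)
    (hlog : Tendsto (fun x => Real.log (S.mInv x) / (δ x ^ 2 * x)) atTop (𝓝 0)) :
    Tendsto (fun x => δ x * x) atTop atTop := by
  refine tendsto_atTop_mono' _ ?_ (Real.tendsto_log_atTop.comp (S.tendsto_mInv k hm))
  filter_upwards [hδ, hlog.eventually (gt_mem_nhds zero_lt_one), eventually_gt_atTop 0]
    with x hδx hx hx0
  rw [div_lt_one (mul_pos (pow_pos hδx.1 2) hx0)] at hx
  refine hx.le.trans (mul_le_mul_of_nonneg_right ?_ hx0.le)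
  nlinarith

section Stream

variable {Ω : Type*} [MeasurableSpace Ω] {P : Measure Ω} [IsProbabilityMeasure P]
  {I : ℤ → Ω → Fin M} {R : ℤ → Ω → ℕ}

theorem IsRequestStream.eventually_upper_tail (h : S.IsRequestStream P I R) (k : Fin M)
    (hm : Tendsto S.m atTop atTop) (hlt : ∀ d, S.pMix d < 1) {δ : ℝ → ℝ}
    (hδ : ∀ᶠ x in atTop, 0 < δ x ∧ δ x ≤ 1)
    (hlog : Tendsto (fun x => Real.log (S.mInv x) / (δ x ^ 2 * x)) atTop (𝓝 0))
    {ε : ℝ} (hε0 : 0 < ε) (hε1 : ε ≤ 1) (a : ℕ) :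
    ∀ᶠ n : ℕ in atTop, P.real {ω | (1 + ε * δ (S.m n)) * S.m n < ∑ d ∈ hits R n ω, S.size d} ≤
      ((n : ℝ) ^ a)⁻¹ := by
  obtain ⟨B, hB1, hB⟩ := S.exists_size_le
  have hB0 : 0 < B := by linarith
  have hmn : Tendsto (fun n : ℕ => S.m n) atTop atTop := hm.comp tendsto_natCast_atTop_atTop
  filter_upwards [hmn.eventually (eventually_exp_le_mInv_pow k hm hδ hlog
    (show 0 < ε ^ 2 / (8 * B) by positivity) a), hmn.eventually hδ,
    hmn.eventually (eventually_gt_atTop 0)] with n hn hδn hn0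
  rw [S.mInv_m k hm hlt (Nat.cast_nonneg n)] at hn
  have hu0 : 0 < ε * δ (S.m n) := mul_pos hε0 hδn.1
  have hu1 : ε * δ (S.m n) ≤ 1 := mul_le_one₀ hε1 hδn.1.le hδn.2
  -- With u = εδ, θ = u/(2B) minimises the Chernoff exponent -θ u m + θ² B m, with value -u² m/(4B),
  -- twice what is needed.
  refine (prob_lt_size_hits_le (θ := ε * δ (S.m n) / (2 * B)) h.measurable_item h.iIndepFun_item
    h.item_law S.size_nonneg hB hB0.le (fun A => sum_le_hasSum A (fun d _ => mul_nonneg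
      (S.size_nonneg d) (sub_nonneg.mpr (pow_le_one₀ (sub_nonneg.mpr (S.pMix_le_one k d))
        (by linarith [S.pMix_nonneg d])))) (S.hasSum_m_nat k n)) (by positivity) ?_ _).trans
        (le_trans (Real.exp_le_exp.mpr ?_) hn)
  · rw [div_mul_eq_mul_div, div_le_one (by positivity)]; nlinarith
  · set u := ε * δ (S.m n)
    have h1 : -(u / (2 * B)) * ((1 + u) * S.m n) + (u / (2 * B) + (u / (2 * B)) ^ 2 * B) * S.m n =
        -(2 * (ε ^ 2 / (8 * B) * (δ (S.m n) ^ 2 * S.m n))) := by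
      simp only [u]; field_simp; ring
    rw [h1]
    have : 0 ≤ ε ^ 2 / (8 * B) * (δ (S.m n) ^ 2 * S.m n) := by positivity
    linarith

theorem IsRequestStream.eventually_lower_tail (h : S.IsRequestStream P I R) (k : Fin M)
    (hm : Tendsto S.m atTop atTop) {δ : ℝ → ℝ}
    (hδ : ∀ᶠ x in atTop, 0 < δ x ∧ δ x ≤ 1)
    (hlog : Tendsto (fun x => Real.log (S.mInv x) / (δ x ^ 2 * x)) atTop (𝓝 0))
    {ε : ℝ} (hε0 : 0 < ε) (hε1 : ε ≤ 1) (a : ℕ) :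
    ∀ᶠ x in atTop, ∀ n : ℕ, (1 + ε * δ x) * x ≤ S.m n →
      P.real {ω | ∑ d ∈ hits R n ω, S.size d ≤ x} ≤ (S.mInv x ^ a)⁻¹ := by
  obtain ⟨B, hB1, hB⟩ := S.exists_size_le
  have hB0 : 0 < B := by linarith
  filter_upwards [eventually_exp_le_mInv_pow k hm hδ hlog
    (show 0 < ε ^ 2 / (8 * B) by positivity) a, hδ, eventually_gt_atTop 0] with x hx hδx hx0 n hn
  have hu0 : 0 < ε * δ x := mul_pos hε0 hδx.1
  have hu1 : ε * δ x ≤ 1 := mul_le_one₀ hε1 hδx.1.le hδx.2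
  -- The smaller θ = u/(4B) leaves an exponent of at most -u² x/(8B), uniformly over all n for which
  -- m(n) is large enough.
  refine (prob_size_hits_le_le (θ := ε * δ x / (4 * B)) h.measurable_item h.iIndepFun_item
    h.item_law S.size_nonneg hB (S.hasSum_m_nat k n) (by positivity) ?_ _).trans
        (le_trans (Real.exp_le_exp.mpr ?_) hx)
  · rw [div_mul_eq_mul_div, div_le_one (by positivity)]; nlinarith
  · have h3 : ε ^ 2 / (8 * B) * (δ x ^ 2 * x) = (ε * δ x) ^ 2 * x / (8 * B) := by ring
    rw [h3]
    set u := ε * δ x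
    have h1 : u / (4 * B) - (u / (4 * B)) ^ 2 * B = u / (4 * B) * (1 - u / 4) := by
      field_simp
    have h2 : 0 ≤ u / (4 * B) * (1 - u / 4) := mul_nonneg (by positivity) (by linarith)
    have h4 := mul_le_mul_of_nonneg_left hn h2
    rw [h1]
    have h5 : u / (4 * B) * x - u / (4 * B) * (1 - u / 4) * ((1 + u) * x) =
        -(u ^ 2 * x / (8 * B)) - (u / (4 * B)) * x * (u / 4 * (1 - u)) := by
      field_simp; ring
    have h6 : 0 ≤ (u / (4 * B)) * x * (u / 4 * (1 - u)) :=
      mul_nonneg (by positivity) (mul_nonneg (by positivity) (by linarith))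
    linarith

end Stream

section Flow

variable {k : Fin M}

theorem q_nonneg (i : ℕ) : 0 ≤ S.q k i := ENNReal.toReal_nonneg

theorem summable_q : Summable (S.q k) :=
  (S.hasSum_law k).summable.comp_injective (S.item_injective k)

theorem p_nonneg (i : ℕ) : 0 ≤ S.p k i := S.pMix_nonneg _

theorem tendsto_p : Tendsto (S.p k) atTop (𝓝 0) :=
  ((S.hasSum_pMix k).summable.comp_injective (S.item_injective k)).tendsto_atTop_zero

theorem p_pos (hev : ∀ᶠ n in atTop, 0 < S.q k n) (i : ℕ) : 0 < S.p k i := by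
  obtain ⟨n, hn, hin⟩ := (hev.and (eventually_ge_atTop i)).exists
  exact ((mul_pos (S.nu_pos k) hn).trans_le (S.nu_mul_law_le_pMix k _)).trans_le
    (S.item_sorted k hin)

/-- Two distinct items of flow k are used, one of them of positive probability. This makes m
strictly increasing, so that its inverse recovers n from m(n). -/
theorem pMix_lt_one (hev : ∀ᶠ n in atTop, 0 < S.q k n) (d : ℕ) : S.pMix d < 1 := by
  obtain ⟨i, hi⟩ : ∃ i, S.item k i ≠ d := by
    by_contra! hcon
    exact zero_ne_one (S.item_injective k ((hcon 0).trans (hcon 1).symm))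
  have h1 := sum_le_hasSum {S.item k i, d} (fun d _ => S.pMix_nonneg d) (S.hasSum_pMix k)
  rw [Finset.sum_pair hi] at h1
  have h2 : 0 < S.pMix (S.item k i) := p_pos hev i
  linarith

theorem tsum_pow_le_laplaceSum (n : ℕ) :
    ∑' i, S.q k i * (1 - S.p k i) ^ n ≤ laplaceSum (S.q k) (S.p k) n := by
  have hle : ∀ i, S.p k i ≤ 1 := fun i => S.pMix_le_one k _
  have hterm : ∀ i, S.q k i * (1 - S.p k i) ^ n ≤ S.q k i * Real.exp (-(S.p k i * n)) := fun i =>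
    mul_le_mul_of_nonneg_left (by
      simpa using one_sub_rpow_le_exp (hle i) (Nat.cast_nonneg n)) (q_nonneg i)
  have hs := summable_laplaceSum (p := S.p k) (q_nonneg (S := S) (k := k)) summable_q p_nonneg
    (Nat.cast_nonneg n)
  exact (hs.of_nonneg_of_le (fun i => mul_nonneg (q_nonneg i)
    (pow_nonneg (sub_nonneg.mpr (hle i)) n)) hterm).tsum_le_tsum hterm hs

theorem laplaceSum_le_tsum_pow_add {n : ℕ} (hn : 1 ≤ n) :
    laplaceSum (S.q k) (S.p k) n ≤
      ∑' i, S.q k i * (1 - S.p k i) ^ n + 8 / n * laplaceSum (S.q k) (S.p k) (n / 2) := by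
  have hle : ∀ i, S.p k i ≤ 1 := fun i => S.pMix_le_one k _
  have hs := summable_laplaceSum (p := S.p k) (q_nonneg (S := S) (k := k)) summable_q p_nonneg
    (Nat.cast_nonneg n)
  have hs2 := (summable_laplaceSum (p := S.p k) (q_nonneg (S := S) (k := k)) summable_q p_nonneg
    (show (0 : ℝ) ≤ n / 2 by positivity)).mul_left (8 / n : ℝ)
  have hs3 : Summable fun i => S.q k i * (1 - S.p k i) ^ n :=
    summable_q.of_nonneg_of_le (fun i => mul_nonneg (q_nonneg i)
      (pow_nonneg (sub_nonneg.mpr (hle i)) n)) fun i => mul_le_of_le_one_right (q_nonneg i)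
        (pow_le_one₀ (sub_nonneg.mpr (hle i)) (by linarith [p_nonneg (S := S) (k := k) i]))
  unfold laplaceSum
  rw [← tsum_mul_left, ← hs3.tsum_add hs2]
  refine hs.tsum_le_tsum (fun i => ?_) (hs3.add hs2)
  have h1 := mul_le_mul_of_nonneg_left (exp_sub_one_sub_pow_le (p_nonneg i) (hle i) hn)
    (q_nonneg (S := S) (k := k) i)
  linarith

end Flow

end CacheModel

/-! ### Asymptotics in terms of m^←(x) -/

namespace CacheModel

variable {M : ℕ} {S : CacheModel M} {k : Fin M}

theorem tendsto_qTail_mul {Φ F : ℝ → ℝ} (hev : ∀ᶠ n in atTop, 0 < S.q k n)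
    (hrel : (fun y : ℕ => (S.qTail k y)⁻¹) ~[atTop] (fun y : ℕ => Φ ((S.p k y)⁻¹)))
    (hΦ : Φ ~[atTop] F) :
    Tendsto (fun y : ℕ => (∑' i, S.q k (y + i)) * F (S.p k y)⁻¹) atTop (𝓝 1) := by
  have hpinv : Tendsto (fun y => (S.p k y)⁻¹) atTop atTop :=
    Tendsto.inv_tendsto_nhdsGT_zero (tendsto_nhdsWithin_iff.mpr
      ⟨tendsto_p, Eventually.of_forall fun i => p_pos hev i⟩)
  have hpos := tsum_nat_add_pos_of_ratio (q_nonneg (S := S) (k := k)) summable_q hev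
  have h1 : (fun y : ℕ => F (S.p k y)⁻¹) ~[atTop] (fun y : ℕ => (S.qTail k y)⁻¹) :=
    (hrel.trans (hΦ.comp_tendsto hpinv)).symm
  have hne : ∀ y, (S.qTail k y)⁻¹ ≠ 0 := fun y => inv_ne_zero (hpos y).ne'
  rw [isEquivalent_iff_tendsto_one (Eventually.of_forall hne)] at h1
  refine h1.congr fun y => ?_
  rw [Pi.div_apply, div_inv_eq_mul, mul_comm]
  rfl

/-- The asymptotic behaviour of the Che miss probability as a function of the characteristic
time. -/
theorem cheMiss_asymptotics
    (hq : Tendsto (fun n => S.q k n / S.q k (n + 1)) atTop (𝓝 1))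
    {Φ l : ℝ → ℝ} {β : ℝ} (hβ : 0 ≤ β)
    (hrel : (fun y : ℕ => (S.qTail k y)⁻¹) ~[atTop] (fun y : ℕ => Φ ((S.p k y)⁻¹)))
    (hl : IsSlowlyVarying l)
    (hl_mono : β = 0 → ∃ x₀ : ℝ, MonotoneOn l (Set.Ici x₀))
    (hΦ : Φ ~[atTop] fun x => x ^ β * l x) :
    Tendsto (fun t => S.cheMiss k t * Φ t) atTop (𝓝 (Real.Gamma (1 + β))) ∧
    (∀ c > 0, Tendsto (fun t => S.cheMiss k (c * t) / S.cheMiss k t) atTop (𝓝 (c ^ (-β)))) ∧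
    ∃ a : ℕ, ∃ c > 0, ∀ t, 1 ≤ t → c ≤ t ^ a * S.cheMiss k t := by
  have hev := eventually_pos_of_ratio q_nonneg hq
  set F : ℝ → ℝ := fun x => x ^ β * l x with hFdef
  have hFpos : ∀ᶠ t in atTop, 0 < F t := by
    filter_upwards [hl.2.1, eventually_gt_atTop 0] with t h1 h2
    exact mul_pos (Real.rpow_pos_of_pos h2 _) h1
  have hFreg : ∀ c > 0, Tendsto (fun t => F (c * t) / F t) atTop (𝓝 (c ^ β)) := fun c hc =>
    hl.tendsto_rpow_mul_div β hc
  have hG := tendsto_lowWeight_inv_mul (p := S.p k) q_nonneg summable_q hq (S.item_sorted k)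
    (p_pos hev) tendsto_p (fun ε hε => hl.eventually_almost_monotone hβ hl_mono hε)
    (tendsto_qTail_mul hev hrel hΦ)
  have hHF : Tendsto (fun t => S.cheMiss k t * F t) atTop (𝓝 (Real.Gamma (1 + β))) :=
    tendsto_laplaceSum_mul hβ q_nonneg summable_q hev (p_pos hev) tendsto_p hFpos hFreg hG
  have hHpos : ∀ {t : ℝ}, 0 ≤ t → 0 < S.cheMiss k t :=
    laplaceSum_pos q_nonneg summable_q p_nonneg hev
  have hΓ : 0 < Real.Gamma (1 + β) := Real.Gamma_pos_of_pos (by linarith)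
  refine ⟨?_, fun c hc => ?_, exists_le_pow_mul_laplaceSum q_nonneg summable_q hev p_nonneg
    tendsto_p (tendsto_lowWeight_ratio q_nonneg summable_q hev tendsto_p hFpos hFreg hG)⟩
  · have h1 := hHF.mul ((isEquivalent_iff_tendsto_one (hFpos.mono fun t ht => ht.ne')).mp hΦ)
    rw [mul_one] at h1
    refine h1.congr' ?_
    filter_upwards [hFpos] with t ht
    rw [Pi.div_apply, mul_assoc, mul_div_cancel₀ _ ht.ne']
  · have hct : Tendsto (fun t : ℝ => c * t) atTop atTop := tendsto_id.const_mul_atTop hc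
    have h1 := ((hHF.comp hct).div hHF hΓ.ne').div (hFreg c hc) (Real.rpow_pos_of_pos hc _).ne'
    rw [div_self hΓ.ne', one_div, ← Real.rpow_neg hc.le] at h1
    refine h1.congr' ?_
    filter_upwards [hFpos, hct.eventually hFpos, eventually_gt_atTop 0] with t h2 h3 ht
    have h4 := (hHpos ht.le).ne'
    have h2 := h2.ne'
    have h3 := h3.ne'
    simp only [Function.comp, Pi.div_apply]
    generalize F (c * t) = A at *
    generalize F t = A' at *
    generalize S.cheMiss k t = A'' at *
    field_simp

section Miss

variable {Ω : Type*} [MeasurableSpace Ω] {P : Measure Ω} [IsProbabilityMeasure P]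
  {I : ℤ → Ω → Fin M} {R : ℤ → Ω → ℕ} {δ f : ℝ → ℝ} {β : ℝ}

theorem inv_pow_succ_le {t c y : ℝ} {a : ℕ} (ht : 0 < t) (hc : 0 < c) (h : c ≤ t ^ a * y) :
    (t ^ (a + 1))⁻¹ ≤ (c * t)⁻¹ * y := by
  rw [inv_mul_eq_div, le_div_iff₀ (by positivity), inv_mul_le_iff₀ (by positivity), pow_succ]
  nlinarith

theorem exists_gap (hf_one : Tendsto f (𝓝[>] 0) (𝓝 1)) {c : ℝ} (hc : 1 < c) :
    ∃ ε : ℝ, 0 < ε ∧ ε ≤ 1 ∧ f ε < c := by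
  obtain ⟨ε, hε1, hε2, hε3⟩ := ((hf_one.eventually (gt_mem_nhds hc)).and
    (((ge_mem_nhds (zero_lt_one' ℝ)).filter_mono nhdsWithin_le_nhds).and
      (self_mem_nhdsWithin (s := Set.Ioi (0 : ℝ))))).exists
  exact ⟨ε, hε3, hε2, hε1⟩

theorem eventually_mInv_lt (hm : Tendsto S.m atTop atTop) (k : Fin M)
    (hf : ∀ ε : ℝ, 0 < ε →
      Tendsto (fun x => S.mInv ((1 + ε * δ x) * x) / S.mInv x) atTop (𝓝 (f ε)))
    {ε c : ℝ} (hε : 0 < ε) (hc : f ε < c) :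
    ∀ᶠ x in atTop, S.mInv ((1 + ε * δ x) * x) < c * S.mInv x := by
  filter_upwards [(hf ε hε).eventually (gt_mem_nhds hc),
    (S.tendsto_mInv k hm).eventually (eventually_gt_atTop 0)] with x h1 h2
  exact (div_lt_iff₀ h2).mp h1

theorem IsRequestStream.eventually_missProb_le (h : S.IsRequestStream P I R)
    (hm : Tendsto S.m atTop atTop)
    (hδ : ∀ᶠ x in atTop, 0 < δ x ∧ δ x ≤ 1)
    (hf : ∀ ε : ℝ, 0 < ε →
      Tendsto (fun x => S.mInv ((1 + ε * δ x) * x) / S.mInv x) atTop (𝓝 (f ε)))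
    (hf_one : Tendsto f (𝓝[>] 0) (𝓝 1))
    (hlog : Tendsto (fun x => Real.log (S.mInv x) / (δ x ^ 2 * x)) atTop (𝓝 0))
    (hev : ∀ᶠ n in atTop, 0 < S.q k n)
    (hreg : ∀ c > 0, Tendsto (fun t => S.cheMiss k (c * t) / S.cheMiss k t) atTop (𝓝 (c ^ (-β))))
    (hlow : ∃ a : ℕ, ∃ c > 0, ∀ t, 1 ≤ t → c ≤ t ^ a * S.cheMiss k t) {b : ℝ} (hb : 1 < b) :
    ∀ᶠ x in atTop, missProb S.size P I R k x ≤ b * S.cheMiss k (S.mInv x) := by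
  have hHpos : ∀ {t : ℝ}, 0 ≤ t → 0 < S.cheMiss k t :=
    laplaceSum_pos q_nonneg summable_q p_nonneg hev
  have hHanti : AntitoneOn (S.cheMiss k) (Set.Ici 0) :=
    laplaceSum_antitoneOn q_nonneg summable_q p_nonneg
  have hτ := S.tendsto_mInv k hm
  obtain ⟨b', hb1, hbb⟩ := exists_between hb
  have hb0 : 0 < b' := by linarith
  obtain ⟨c, hc0, hc1, hc⟩ := exists_lt_one_eventually_le_mul
    ((eventually_ge_atTop 0).mono fun t ht => hHpos ht) hreg hb1
  obtain ⟨c', hcc, hc1'⟩ := exists_between hc1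
  have hc0' : 0 < c' := hc0.trans hcc
  obtain ⟨ε, hε0, hε1, hε⟩ := exists_gap hf_one (one_lt_inv₀ hc0' |>.mpr hc1')
  obtain ⟨a, c₀, hc₀, hac⟩ := hlow
  have hn : Tendsto (fun x => ⌊c' * S.mInv x⌋₊) atTop atTop :=
    tendsto_nat_floor_atTop.comp (hτ.const_mul_atTop hc0')
  -- The window is n = ⌊c'τ⌋ with c < c' < 1: the gap between c and c' absorbs the rounding, and
  -- f(ε) < 1/c' puts (1 + εδ(m n)) m(n) below x. The exponent a + 1, one above the decay order of
  -- H, makes the tail O(1/n) relative to H(n).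
  have hy : Tendsto (fun n : ℕ => S.m n) atTop atTop := hm.comp tendsto_natCast_atTop_atTop
  have hdecay : Tendsto (fun n : ℕ => b' * (1 + (c₀ * n)⁻¹)) atTop (𝓝 (b' * (1 + 0))) :=
    ((tendsto_inv_atTop_zero.comp
      (tendsto_natCast_atTop_atTop.const_mul_atTop hc₀)).const_add 1).const_mul b'
  rw [add_zero, mul_one] at hdecay
  filter_upwards [hn.eventually (h.eventually_upper_tail k hm (pMix_lt_one hev) hδ hlog hε0 hε1
      (a + 1)), hn.eventually (hy.eventually (eventually_mInv_lt hm k hf hε0 hε)),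
    hτ.eventually hc, hτ.eventually (eventually_ge_atTop (1 / (c' - c))),
    hn.eventually (eventually_ge_atTop 1), hn.eventually (hdecay.eventually (gt_mem_nhds hbb))]
    with x h1 h2 h3 h4 h5 h6
  set τ := S.mInv x with hτdef
  set n := ⌊c' * τ⌋₊
  have hn0 : (n : ℝ) ∈ Set.Ici 0 := Set.mem_Ici.mpr n.cast_nonneg
  have hn1 : (1 : ℝ) ≤ n := by exact_mod_cast h5
  have hτ0 : 0 < τ := lt_of_lt_of_le (by apply one_div_pos.mpr; linarith) h4
  have hnle : (n : ℝ) ≤ c' * τ := Nat.floor_le (by positivity)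
  have hnge : c * τ ≤ n := by
    have := Nat.lt_floor_add_one (c' * τ)
    rw [div_le_iff₀ (by linarith)] at h4
    change c' * τ < n + 1 at this
    linarith
  rw [S.mInv_m k hm (pMix_lt_one hev) n.cast_nonneg] at h2
  have h7 : (1 + ε * δ (S.m n)) * S.m n < x := by
    by_contra! hcon
    have h8 := S.mInv_monotone hm hcon
    have h9 : c'⁻¹ * n ≤ τ := (inv_mul_le_iff₀ hc0').mpr hnle
    linarith
  have h8 : P.real {ω | x < ∑ d ∈ hits R n ω, S.size d} ≤ ((n : ℝ) ^ (a + 1))⁻¹ :=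
    (measureReal_mono fun ω hω => h7.trans hω).trans h1
  have hHn : S.cheMiss k n ≤ b' * S.cheMiss k τ :=
    (hHanti (show (0 : ℝ) ≤ c * τ by positivity) hn0 hnge).trans h3
  have h9 : ((n : ℝ) ^ (a + 1))⁻¹ ≤ (c₀ * n)⁻¹ * S.cheMiss k n :=
    inv_pow_succ_le (by linarith) hc₀ (hac n hn1)
  have h10 := tsum_pow_le_laplaceSum (S := S) (k := k) n
  have h11 : (0 : ℝ) ≤ 1 + (c₀ * n)⁻¹ := by positivity
  calc missProb S.size P I R k x ≤ S.cheMiss k n + (c₀ * n)⁻¹ * S.cheMiss k n :=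
        (h.missProb_le k n x).trans (add_le_add h10 (h8.trans h9))
    _ = (1 + (c₀ * n)⁻¹) * S.cheMiss k n := by ring
    _ ≤ (1 + (c₀ * n)⁻¹) * (b' * S.cheMiss k τ) := mul_le_mul_of_nonneg_left hHn h11
    _ = b' * (1 + (c₀ * n)⁻¹) * S.cheMiss k τ := by ring
    _ ≤ b * S.cheMiss k τ := mul_le_mul_of_nonneg_right h6.le (hHpos hτ0.le).le

theorem IsRequestStream.eventually_le_missProb (h : S.IsRequestStream P I R)
    (hm : Tendsto S.m atTop atTop)
    (hδ : ∀ᶠ x in atTop, 0 < δ x ∧ δ x ≤ 1)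
    (hf : ∀ ε : ℝ, 0 < ε →
      Tendsto (fun x => S.mInv ((1 + ε * δ x) * x) / S.mInv x) atTop (𝓝 (f ε)))
    (hf_one : Tendsto f (𝓝[>] 0) (𝓝 1))
    (hlog : Tendsto (fun x => Real.log (S.mInv x) / (δ x ^ 2 * x)) atTop (𝓝 0))
    (hev : ∀ᶠ n in atTop, 0 < S.q k n)
    (hreg : ∀ c > 0, Tendsto (fun t => S.cheMiss k (c * t) / S.cheMiss k t) atTop (𝓝 (c ^ (-β))))
    (hlow : ∃ a : ℕ, ∃ c > 0, ∀ t, 1 ≤ t → c ≤ t ^ a * S.cheMiss k t) {b : ℝ} (hb : b < 1) :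
    ∀ᶠ x in atTop, b * S.cheMiss k (S.mInv x) ≤ missProb S.size P I R k x := by
  have hHpos : ∀ {t : ℝ}, 0 ≤ t → 0 < S.cheMiss k t :=
    laplaceSum_pos q_nonneg summable_q p_nonneg hev
  have hHanti : AntitoneOn (S.cheMiss k) (Set.Ici 0) :=
    laplaceSum_antitoneOn q_nonneg summable_q p_nonneg
  have hτ := S.tendsto_mInv k hm
  obtain ⟨b', hbb, hb1⟩ := exists_between hb
  obtain ⟨c, hc1, hc⟩ := exists_one_lt_eventually_mul_le
    ((eventually_ge_atTop 0).mono fun t ht => hHpos ht) hreg hb1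
  obtain ⟨c', hc1', hcc⟩ := exists_between hc1
  obtain ⟨ε, hε0, hε1, hε⟩ := exists_gap hf_one hc1'
  obtain ⟨a, c₀, hc₀, hac⟩ := hlow
  -- K collects two errors of order H(τ)/τ: replacing (1-p)^n by e^{-pn}, where H(n/2) is bounded by
  -- H(τ/2), and the lower size tail. The window is n = ⌈c'τ⌉ with 1 < c' < c.
  set K : ℝ := 8 * ((1 / 2) ^ (-β) + 1) + c₀⁻¹
  have hhalf := (hreg (1 / 2) (by norm_num)).eventually (gt_mem_nhds (lt_add_one _))
  have hdecay : Tendsto (fun t : ℝ => b' - K * t⁻¹) atTop (𝓝 (b' - K * 0)) :=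
    (tendsto_inv_atTop_zero.const_mul K).const_sub b'
  rw [mul_zero, sub_zero] at hdecay
  filter_upwards [h.eventually_lower_tail k hm hδ hlog hε0 hε1 (a + 1),
    eventually_mInv_lt hm k hf hε0 hε, hτ.eventually hc,
    hτ.eventually (eventually_ge_atTop (1 / (c - c'))), hτ.eventually (eventually_ge_atTop 1),
    hτ.eventually (hdecay.eventually (lt_mem_nhds hbb)), hτ.eventually hhalf,
    eventually_ge_atTop 0] with x h1 h2 h3 h4 h5 h6 h7 hx0
  set τ := S.mInv x with hτdef
  have hτ0 : 0 < τ := by linarith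
  set n := ⌈c' * τ⌉₊
  have hnge : c' * τ ≤ n := Nat.le_ceil _
  have hnle : n ≤ c * τ := by
    have := Nat.ceil_lt_add_one (show 0 ≤ c' * τ by positivity)
    rw [div_le_iff₀ (by linarith)] at h4
    change (n : ℝ) < _ at this
    linarith
  have hτn : τ ≤ n := by nlinarith
  have hn0 : (n : ℝ) ∈ Set.Ici 0 := Set.mem_Ici.mpr n.cast_nonneg
  have hn1 : (1 : ℝ) ≤ n := h5.trans hτn
  have h8 := h1 n (S.le_m_of_mInv_lt k hm (h2.trans_le hnge))
  have h9 : (τ ^ (a + 1))⁻¹ ≤ (c₀ * τ)⁻¹ * S.cheMiss k τ :=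
    inv_pow_succ_le (by linarith) hc₀ (hac τ h5)
  have hHτ := hHpos hτ0.le
  have h10 : b' * S.cheMiss k τ ≤ S.cheMiss k n :=
    h3.trans (hHanti hn0 (show (0 : ℝ) ≤ c * τ by positivity) hnle)
  have h11 : 8 / n * S.cheMiss k (n / 2) ≤
      8 * τ⁻¹ * (((1 / 2) ^ (-β) + 1) * S.cheMiss k τ) := by
    have h12 := (div_le_iff₀ hHτ).mp h7.le
    have h13 : S.cheMiss k (n / 2) ≤ S.cheMiss k (1 / 2 * τ) :=
      hHanti (show (0 : ℝ) ≤ 1 / 2 * τ by positivity) (show (0 : ℝ) ≤ n / 2 by positivity)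
        (by linarith)
    rw [div_eq_mul_inv]
    have := (hHpos (show (0 : ℝ) ≤ n / 2 by positivity)).le
    gcongr
    exact h13.trans h12
  have h14 := laplaceSum_le_tsum_pow_add (S := S) (k := k) (n := n) (by exact_mod_cast hn1)
  change S.cheMiss k n ≤ _ + 8 / n * S.cheMiss k (n / 2) at h14
  have h15 := h.le_missProb k n hx0
  have h16 := mul_le_mul_of_nonneg_right h6.le hHτ.le
  have h17 : (b' - K * τ⁻¹) * S.cheMiss k τ = b' * S.cheMiss k τ -
      8 * τ⁻¹ * (((1 / 2) ^ (-β) + 1) * S.cheMiss k τ) - (c₀ * τ)⁻¹ * S.cheMiss k τ := by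
    simp only [K, mul_inv]; ring
  linarith

theorem isEquivalent_cheMiss_comp (hm : Tendsto S.m atTop atTop)
    (hδ : ∀ᶠ x in atTop, 0 < δ x ∧ δ x ≤ 1)
    (hf : ∀ ε : ℝ, 0 < ε →
      Tendsto (fun x => S.mInv ((1 + ε * δ x) * x) / S.mInv x) atTop (𝓝 (f ε)))
    (hf_one : Tendsto f (𝓝[>] 0) (𝓝 1))
    (hlog : Tendsto (fun x => Real.log (S.mInv x) / (δ x ^ 2 * x)) atTop (𝓝 0))
    (hev : ∀ᶠ n in atTop, 0 < S.q k n)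
    (hreg : ∀ c > 0, Tendsto (fun t => S.cheMiss k (c * t) / S.cheMiss k t) atTop (𝓝 (c ^ (-β))))
    {T : ℝ → ℝ} (hT : ∀ᶠ x in atTop, 0 ≤ T x ∧ S.cheSize (T x) = x) :
    (fun x => S.cheMiss k (T x)) ~[atTop] (fun x => S.cheMiss k (S.mInv x)) := by
  have hHpos : ∀ {t : ℝ}, 0 ≤ t → 0 < S.cheMiss k t :=
    laplaceSum_pos q_nonneg summable_q p_nonneg hev
  have hHanti : AntitoneOn (S.cheMiss k) (Set.Ici 0) :=
    laplaceSum_antitoneOn q_nonneg summable_q p_nonneg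
  have hτ := S.tendsto_mInv k hm
  have hτ0 := hτ.eventually (eventually_ge_atTop 0)
  have hTge : ∀ᶠ x in atTop, S.mInv x ≤ T x := by
    filter_upwards [hT] with x hx
    exact S.mInv_le hx.1 (hx.2.ge.trans (S.cheSize_le_m k hx.1))
  refine isEquivalent_of_eventually_le (hτ0.mono fun x hx => hHpos hx) (fun b hb => ?_)
    fun b hb => ?_
  · filter_upwards [hτ0, hTge, hT] with x h1 h2 h3
    have := hHanti h1 h3.1 h2
    nlinarith [hHpos h1]
  · obtain ⟨c, hc1, hc⟩ := exists_one_lt_eventually_mul_le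
      ((eventually_ge_atTop 0).mono fun t ht => hHpos ht) hreg hb
    obtain ⟨ε, hε0, -, hε⟩ := exists_gap hf_one hc1
    obtain ⟨B, -, hB⟩ := S.exists_size_le
    filter_upwards [hτ.eventually hc, hT, eventually_mInv_lt hm k hf hε0 hε,
      (tendsto_mul_self_atTop k hm hδ hlog).eventually (eventually_gt_atTop (B / ε)),
      hTge, hτ.eventually (eventually_ge_atTop 1)] with x h1 h2 h3 h4 h5 h6
    refine h1.trans (hHanti h2.1 (show 0 ≤ c * S.mInv x by nlinarith) ?_)
    -- If T exceeded cτ, it would exceed m^←((1 + εδ)x), so m(T) would be at least x + εδx. But m(T)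
    -- ≤ x + B, and εδx > B for large x.
    by_contra! hcon
    have h7 := S.le_m_of_mInv_lt k hm (h3.trans hcon)
    have h8 := S.m_le_cheSize_add k hB (h6.trans h5)
    rw [div_lt_iff₀ hε0] at h4
    rw [h2.2] at h8
    nlinarith

end Miss

end CacheModel

/-! ### Conclusion -/

theorem theorem2 {M : ℕ} (S : CacheModel M)
    {Ω : Type*} [MeasurableSpace Ω] (P : Measure Ω) [IsProbabilityMeasure P]
    (I : ℤ → Ω → Fin M) (R : ℤ → Ω → ℕ) (hIR : S.IsRequestStream P I R)
    (hm : Tendsto S.m atTop atTop)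
    -- the function `δ` and the growth of the inverse of `m`
    (δ f : ℝ → ℝ)
    (hδ : ∀ᶠ x in atTop, 0 < δ x ∧ δ x ≤ 1)
    (hf : ∀ ε : ℝ, 0 < ε →
      Tendsto (fun x => S.mInv ((1 + ε * δ x) * x) / S.mInv x) atTop (𝓝 (f ε)))
    (hf_one : Tendsto f (𝓝[>] 0) (𝓝 1))
    (hδ_reg : ∀ ε : ℝ, 0 < ε → ∃ h₁ h₂ h₃ h₄ x₀ : ℝ,
      0 < h₁ ∧ h₁ < h₂ ∧ 0 < h₃ ∧ h₃ < h₄ ∧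
      ∀ x, x₀ < x →
        (h₁ < δ x / δ (x + ε * δ x) ∧ δ x / δ (x + ε * δ x) < h₂) ∧
        (h₃ < δ (x - ε * δ x) / δ x ∧ δ (x - ε * δ x) / δ x < h₄))
    (hlog : Tendsto (fun x => Real.log (S.mInv x) / (δ x ^ 2 * x)) atTop (𝓝 0))
    -- the flow `k` under consideration
    (k : Fin M)
    (hq : Tendsto (fun n => S.q k n / S.q k (n + 1)) atTop (𝓝 1))
    (Φ l : ℝ → ℝ) (β : ℝ) (hβ : 0 ≤ β)
    (hrel : (fun y : ℕ => (S.qTail k y)⁻¹) ~[atTop] (fun y : ℕ => Φ ((S.p k y)⁻¹)))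
    (hl : IsSlowlyVarying l)
    (hl_mono : β = 0 → ∃ x₀ : ℝ, MonotoneOn l (Set.Ici x₀))
    (hΦ : Φ ~[atTop] fun x => x ^ β * l x) :
    -- the characteristic time is well defined
    (∀ x : ℝ, 0 ≤ x → ∃! T : ℝ, 0 ≤ T ∧ S.cheSize T = x) ∧
    -- the Che approximation is asymptotically exact
    ∀ T : ℝ → ℝ, (∀ᶠ x in atTop, 0 ≤ T x ∧ S.cheSize (T x) = x) →
      (fun x => S.cheMiss k (T x)) ~[atTop] (fun x => missProb S.size P I R k x) ∧
      (fun x => missProb S.size P I R k x) ~[atTop]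
        (fun x => Real.Gamma (1 + β) / Φ (S.mInv x)) := by
  obtain ⟨hlim, hreg, hlow⟩ := CacheModel.cheMiss_asymptotics hq hβ hrel hl hl_mono hΦ
  have hev := eventually_pos_of_ratio CacheModel.q_nonneg hq
  have hτ := S.tendsto_mInv k hm
  have hHpos : ∀ᶠ x in atTop, 0 < S.cheMiss k (S.mInv x) :=
    (hτ.eventually (eventually_ge_atTop 0)).mono fun x hx =>
      laplaceSum_pos CacheModel.q_nonneg CacheModel.summable_q CacheModel.p_nonneg hev hx
  have hΓ : 0 < Real.Gamma (1 + β) := Real.Gamma_pos_of_pos (by linarith)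
  refine ⟨fun x hx => S.existsUnique_cheSize_eq k hm hx, fun T hT => ?_⟩
  have hmiss : (fun x => missProb S.size P I R k x) ~[atTop]
      (fun x => S.cheMiss k (S.mInv x)) :=
    isEquivalent_of_eventually_le hHpos
      (fun b hb => hIR.eventually_missProb_le hm hδ hf hf_one hlog hev hreg hlow hb)
      fun b hb => hIR.eventually_le_missProb hm hδ hf hf_one hlog hev hreg hlow hb
  refine ⟨(CacheModel.isEquivalent_cheMiss_comp hm hδ hf hf_one hlog hev hreg hT).trans
    hmiss.symm, hmiss.trans ?_⟩
  -- Φ cannot vanish at τ for large x, since H(τ) Φ(τ) tends to Γ(1+β) > 0.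
  have hΦ0 : ∀ᶠ x in atTop, Φ (S.mInv x) ≠ 0 := by
    filter_upwards [(hlim.comp hτ).eventually (lt_mem_nhds hΓ)] with x hx h0
    simp [h0] at hx
  rw [isEquivalent_iff_tendsto_one (hΦ0.mono fun x hx => div_ne_zero hΓ.ne' hx)]
  have h1 := (hlim.comp hτ).div_const (Real.Gamma (1 + β))
  rw [div_self hΓ.ne'] at h1
  refine h1.congr fun x => ?_
  simp only [Function.comp, Pi.div_apply]
  rw [div_div_eq_mul_div]
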